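/- Let $\Omega=(-\tfrac12,\tfrac12)$ with Lebesgue measure $\mathcal L^1$. Let $K=\{(\alpha,\zeta)\in\mathbb R^2:|\alpha|+|\zeta|\le 2\}$, let $P_K$ be the euclidean projection onto $K$, let $N^\varepsilon_K(x)=\frac1\varepsilon(x-P_K(x))$, and let $H(\xi,\theta)=\sup_{(\alpha,\zeta)\in K}(\alpha\xi+\zeta\theta)=2(|\xi|\vee|\theta|)$. Let $V\colon\mathbb R\to\mathbb R$ be an even $C^2$ function such that $-M\le V''\le 0$ for some constant $M$ and such that $V'(\theta)=-1$ if and only if $\theta\ge 1$. Let $z_0\colon[-\tfrac12,\tfrac12]\to\mathbb R$ be continuous with $z_0(0)=1>z_0(y)\ge 0$ for every $y\ne 0$. The boundary datum is $w(t,y)=ty$, prescribed at both end points $y=\pm\tfrac12$, the initial condition is $(u_0,e_0,p_0,z_0)=(0,0,0,z_0)$, and the elastic law is $\sigma=e$. *Regularized problem.* For $\varepsilon>0$ a solution of the $\varepsilon$-regularized evolution problem is a quadruple $(u_\varepsilon,e_\varepsilon,p_\varepsilon,z_\varepsilon)$ with $u_\varepsilon\in H^1_{loc}([0,\infty);H^1(\Omega))$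 and $e_\varepsilon,p_\varepsilon,z_\varepsilon\in H^1_{loc}([0,\infty);L^2(\Omega))$ that takes the initial value $(0,0,0,z_0)$ at $t=0$ and satisfies, for every $t>0$, $Du_\varepsilon(t)=e_\varepsilon(t)+p_\varepsilon(t)$ in $\Omega$, $u_\varepsilon(t)=w(t)$ at $\pm\tfrac12$ and $De_\varepsilon(t)=0$ in $\Omega$, and, for a.e. $t>0$, $(\dot p_\varepsilon(t),\dot z_\varepsilon(t))=N^\varepsilon_K(e_\varepsilon(t),-V'(z_\varepsilon(t)))$ a.e. in $\Omega$. *Generalized Young measures.* Let $\Xi=\mathbb R\times\mathbb R$, and let $C^{\rm hom}_m$ be the space of continuous functions $f(y,\xi,\eta)$ on $[-\tfrac12,\tfrac12]\times\Xi^m\times\mathbb R$ that are positively one-homogeneous in $(\xi,\eta)$. A generalized Young measure with values in $\Xi^m$ is a bounded linear functional $\mu$ on $C^{\rm hom}_m$ such that $\langle f,\mu\rangle\ge 0$ if $f\ge 0$, $\langle f,\mu\rangle=0$ if $f$ vanishes for $\eta\ge 0$, and $\langle\varphi(y)\eta,\mu\rangle=\int_\Omega\varphi\,dy$ for every $\varphi\in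 C([-\tfrac12,\tfrac12])$. For bounded measures $p_i,z_i$ on $[-\tfrac12,\tfrac12]$, $i=1,\dots,m$, the generalized Young measure $\delta_{((p_1,z_1),\dots,(p_m,z_m))}$ is defined by $$f\mapsto\int f\Big(y,\Big(\frac{dp_i}{d\lambda},\frac{dz_i}{d\lambda}\Big)_{i},\frac{d\mathcal L^1}{d\lambda}\Big)\,d\lambda,$$ where $\lambda$ is any bounded nonnegative measure with respect to which $\mathcal L^1$ and all $p_i,z_i$ are absolutely continuous. A compatible system $\mu$ assigns to all times $0\le t_1<\dots<t_m$ a generalized Young measure $\mu_{t_1\dots t_m}$ with values in $\Xi^m$, and $\mu_{s_1\dots s_n}$ is the image of $\mu_{t_1\dots t_m}$ under the coordinate projection whenever $\{s_j\}\subset\{t_i\}$. *Approximable quasistatic evolution.* This is a triple $(u,e,\mu)$ with $u\in L^\infty_{loc}([0,\infty);BV(\Omega))$, $e\in L^\infty_{loc}([0,\infty);L^2(\Omega))$ and $\mu$ a compatible system, all weakly* left-continuous (for $\mu$: $\mu_{s_1\dots s_m}\rightharpoonup\mu_{t_1\dots t_m}$ weakly* as $s_i\to t_i$ with $0\le s_i\le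 t_i$ and $s_1<\dots<s_m$), for which there are a positive sequence $\varepsilon_k\to 0$, a set $\Theta\subset[0,\infty)$ of full measure containing $0$, and solutions $(u_{\varepsilon_k},e_{\varepsilon_k},p_{\varepsilon_k},z_{\varepsilon_k})$ of the $\varepsilon_k$-regularized problems with $u_{\varepsilon_k}(t)\rightharpoonup u(t)$ weakly* in $BV(\Omega)$ and $e_{\varepsilon_k}(t)\rightharpoonup e(t)$ weakly in $L^2(\Omega)$ for every $t\in\Theta$, and $\delta_{((p_{\varepsilon_k}(t_1),z_{\varepsilon_k}(t_1)),\dots,(p_{\varepsilon_k}(t_m),z_{\varepsilon_k}(t_m)))}\rightharpoonup\mu_{t_1\dots t_m}$ weakly* for all $t_1<\dots<t_m$ in $\Theta$. The dissipation of $\mu$ on $[a,b]$ is $$\mathcal D_H(\mu;a,b)=\sup\sum_{i=1}^k\langle H(\xi_i-\xi_{i-1},\theta_i-\theta_{i-1}),\mu_{t_0\dots t_k}(y,\xi_0,\theta_0,\dots,\xi_k,\theta_k,\eta)\rangle,$$ the supremum being taken over all subdivisions $a=t_0<\dots<t_k=b$. Let $\{V\}(\theta,\eta)=\eta V(\theta/\eta)$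 for $\eta>0$ and $\{V\}(\theta,\eta)=V^\infty(\theta)=\lim_{s\to+\infty}V(s\theta)/s$ for $\eta\le 0$. **Theorem (strain localization).** Let $(u,e,\mu)$ be an approximable quasistatic evolution for these data. Then for every $t\ge 0$, as elements of $BV(\Omega)$ and $L^2(\Omega)$ respectively (that is, for a.e. $y\in\Omega$), $$u(t,y)=\begin{cases}ty&\text{if }t\le 1,\\ y+\tfrac12(t-1)&\text{if }t>1,\ y>0,\\ y-\tfrac12(t-1)&\text{if }t>1,\ y<0,\end{cases}\qquad e(t)=t\wedge 1,$$ and $$\mu_t=\delta_{(p(t),z(t))},\qquad p(t)=(t-1)^+\delta_0,\qquad z(t)=z_0+(t-1)^+\delta_0,$$ where $\delta_0$ is the unit Dirac mass at $0$. Moreover, for every $T>0$, $\mathcal D_H(\mu;0,T)=2(T-1)^+$, the function $\{V\}$ is continuous and positively one-homogeneous, and the energy inequality holds with equality: $$\frac12\int_\Omega e(T)^2\,dy+\mathcal D_H(\mu;0,T)+\langle\{V\}(\theta,\eta),\mu_T(y,\xi,\theta,\eta)\rangle=\frac12\int_\Omega e_0^2\,dy+\int_\Omega V(z_0)\,dy+\int_0^T\!\!\int_\Omega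 e(t)\,D\dot w(t)\,dy\,dt .$$ -/

import Mathlib

open MeasureTheory Filter Topology Set

noncomputable section

namespace ShearBand

/-! ### The reference configuration in dimension one -/

/-- The closure `[-1/2, 1/2]` of the reference configuration `Ω = (-1/2, 1/2)`, with the topology,
the Borel sets and the Lebesgue measure `volume` induced by `ℝ`.  The two end points are null, so
`L^r(Ω)` is `Lp ℝ r (volume : Measure Body)`. -/
abbrev Body : Type := Icc (-(1 / 2) : ℝ) (1 / 2)

instance : MeasureSpace Body where
  volume := (volume : Measure ℝ).comap Subtype.val

def leftEnd : Body := ⟨-(1 / 2), by norm_num⟩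

def rightEnd : Body := ⟨1 / 2, by norm_num⟩

def origin : Body := ⟨0, by norm_num⟩

abbrev L2 : Type := Lp ℝ 2 (volume : Measure Body)

/-- Test functions: the space `C_c^∞(Ω)`. -/
def IsTest (φ : ℝ → ℝ) : Prop :=
  ContDiff ℝ ((⊤ : ℕ∞) : WithTop ℕ∞) φ ∧ HasCompactSupport φ ∧ tsupport φ ⊆ Ioo (-(1 / 2)) (1 / 2)

/-- The integral `⟨φ, ν⟩` of a scalar function with respect to a bounded signed measure. -/
def pairing (φ : Body → ℝ) (ν : SignedMeasure Body) : ℝ :=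
  VectorMeasure.integral ν φ (ContinuousLinearMap.lsmul ℝ ℝ)

/-- An element of the Sobolev space `H¹(Ω)`, together with its weak derivative. -/
structure H1Fun where
  val : L2
  grad : L2
  weak_deriv : ∀ φ : ℝ → ℝ, IsTest φ →
    ∫ y : Body, val y * deriv φ y = -∫ y : Body, grad y * φ y

/-- The trace at an end point `a`: the value at `a` of the continuous representative. -/
def HasTrace (v : H1Fun) (a : Body) (c : ℝ) : Prop :=
  ∃ v' : C(Body, ℝ), (∀ᵐ y : Body, v.val y = v' y) ∧ v' a = c

/-- An element of `BV(Ω) = BD(Ω)`, together with its distributional derivative, which is a bounded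
measure on the open set `Ω` (it does not charge the end points). -/
structure BVFun where
  val : Lp ℝ 1 (volume : Measure Body)
  grad : SignedMeasure Body
  grad_left : grad {leftEnd} = 0
  grad_right : grad {rightEnd} = 0
  distrib_deriv : ∀ φ : ℝ → ℝ, IsTest φ →
    ∫ y : Body, val y * deriv φ y = -pairing (fun y => φ y) grad

/-- Weak* convergence in `BV(Ω)` of functions `v i` with derivatives `ν i`: weak convergence in
`L¹(Ω)` of the functions, and weak* convergence in `M_b(Ω)`, the dual of `C_0(Ω)`, of the
derivatives. -/
def TendstoBV {ι : Type} (l : Filter ι) (v : ι → Body → ℝ) (ν : ι → SignedMeasure Body)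
    (v₀ : Body → ℝ) (ν₀ : SignedMeasure Body) : Prop :=
  (∀ g : Body → ℝ, Measurable g → (∃ C : ℝ, ∀ y, |g y| ≤ C) →
    Tendsto (fun i => ∫ y : Body, v i y * g y) l (𝓝 (∫ y : Body, v₀ y * g y))) ∧
  (∀ φ : C(Body, ℝ), φ leftEnd = 0 → φ rightEnd = 0 →
    Tendsto (fun i => pairing φ (ν i)) l (𝓝 (pairing φ ν₀)))

/-- Weak convergence in `L²(Ω)`. -/
def TendstoL2 {ι : Type} (l : Filter ι) (v : ι → L2) (v₀ : L2) : Prop :=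
  ∀ g : L2, Tendsto (fun i => ∫ y : Body, v i y * g y) l (𝓝 (∫ y : Body, v₀ y * g y))

/-- `f` belongs to `H¹_loc([0,+∞); L²(Ω))` and `f'` is its time derivative: `f'` is in
`L²([0,T]; L²(Ω))` for every `T` and `f` is its primitive. -/
def HasTimeDeriv (f f' : ℝ → L2) : Prop :=
  (∀ T > 0, MemLp f' 2 (volume.restrict (Ioc 0 T))) ∧
  ∀ t ≥ 0, f t = f 0 + ∫ s in (0 : ℝ)..t, f' s

/-! ### The elastic domain -/

/-- `q` is the euclidean projection `P_K(x)` of `x` onto the closed convex set `K`. -/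
def IsProjection (K : Set (ℝ × ℝ)) (x q : ℝ × ℝ) : Prop :=
  q ∈ K ∧ ∀ k ∈ K, (x.1 - q.1) ^ 2 + (x.2 - q.2) ^ 2 ≤ (x.1 - k.1) ^ 2 + (x.2 - k.2) ^ 2

/-- `r = N_K^ε(x) = (x - P_K(x)) / ε`. -/
def IsViscousRate (ε : ℝ) (K : Set (ℝ × ℝ)) (x r : ℝ × ℝ) : Prop :=
  ∃ q, IsProjection K x q ∧ r = ε⁻¹ • (x - q)

/-- The support function `H(ξ,θ) = sup {σ ξ + ζ θ : (σ,ζ) ∈ K}` of `K`. -/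
def supportFunction (K : Set (ℝ × ℝ)) (v : ℝ × ℝ) : ℝ :=
  sSup ((fun q : ℝ × ℝ => q.1 * v.1 + q.2 * v.2) '' K)

/-! ### The regularized evolution -/

/-- `(u, e, p, z)` is a solution of the `ε`-regularized evolution problem in dimension one with
`ℂ ξ = 2 G ξ`, elastic domain `K`, softening potential `V`, boundary datum `w` prescribed at both end
points (so that there is no Neumann part of the boundary), and initial condition
`(u₀, e₀, p₀, z₀)`. -/
structure IsRegularizedEvolution (G : ℝ) (K : Set (ℝ × ℝ)) (V : ℝ → ℝ) (w : ℝ → ℝ → ℝ)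
    (u₀ e₀ p₀ z₀ : Body → ℝ) (ε : ℝ)
    (u : ℝ → H1Fun) (e p z : ℝ → L2) : Prop where
  regularity_u : (∃ u', HasTimeDeriv (fun t => (u t).val) u') ∧
    ∃ u', HasTimeDeriv (fun t => (u t).grad) u'
  regularity_e : ∃ e', HasTimeDeriv e e'
  initial_u : ∀ᵐ y : Body, (u 0).val y = u₀ y
  initial_e : ∀ᵐ y : Body, e 0 y = e₀ y
  initial_p : ∀ᵐ y : Body, p 0 y = p₀ y
  initial_z : ∀ᵐ y : Body, z 0 y = z₀ y
  kinematic : ∀ t > 0, (u t).grad = e t + p t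
  boundary : ∀ t > 0, ∀ a : Body, a = leftEnd ∨ a = rightEnd → HasTrace (u t) a (w t a)
  equilibrium : ∀ t > 0, ∀ φ : ℝ → ℝ, IsTest φ → ∫ y : Body, (2 * G * e t y) * deriv φ y = 0
  flow_rule : ∃ p' z' : ℝ → L2, HasTimeDeriv p p' ∧ HasTimeDeriv z z' ∧
    ∀ᵐ t ∂(volume.restrict (Ioi (0 : ℝ))), ∀ᵐ y : Body,
      IsViscousRate ε K (2 * G * e t y, -deriv V (z t y)) (p' t y, z' t y)

/-! ### Generalized Young measures -/

/-- The space `Ξ^m × ℝ` with `Ξ = ℝ × ℝ`; a point is written `(ξ, η)`. -/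
abbrev Fibre (m : ℕ) : Type := (Fin m → ℝ × ℝ) × ℝ

/-- The space `C^hom([-1/2,1/2] × Ξ^m × ℝ)` of the continuous functions `f` such that `f(y, ·)` is
positively homogeneous of degree one. -/
def CHom (m : ℕ) : Submodule ℝ C(Body × Fibre m, ℝ) where
  carrier := {f | ∀ (y : Body) (c : ℝ), 0 ≤ c → ∀ v : Fibre m, f (y, c • v) = c * f (y, v)}
  add_mem' := by
    intro f g hf hg y c hc v
    simp [hf y c hc v, hg y c hc v, mul_add]
  zero_mem' := by
    intro y c _ v
    simp
  smul_mem' := by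
    intro a f hf y c hc v
    simp [hf y c hc v, mul_left_comm]

/-- The function `(y, ξ, η) ↦ φ(y) η`. -/
def CHom.eta {m : ℕ} (φ : C(Body, ℝ)) : CHom m :=
  ⟨⟨fun x => φ x.1 * x.2.2, by fun_prop⟩, by
    intro y c _ v
    simp [mul_left_comm]⟩

/-- The function `(y, ξ, η) ↦ f(y, (ξ_{ι 1}, …, ξ_{ι n}), η)`. -/
def CHom.comap {n m : ℕ} (ι : Fin n → Fin m) (f : CHom n) : CHom m :=
  ⟨⟨fun x => f.1 (x.1, (fun i => x.2.1 (ι i), x.2.2)), by fun_prop⟩, by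
    intro y c hc v
    exact f.2 y c hc (fun i => v.1 (ι i), v.2)⟩

/-- `L` belongs to `GY([-1/2,1/2]; Ξ^m)`. The norm on `Ξ^m × ℝ` used in `bounded` is equivalent to
the euclidean one. -/
structure IsGenYoungMeasure {m : ℕ} (L : CHom m →ₗ[ℝ] ℝ) : Prop where
  bounded : ∃ C : ℝ, ∀ (f : CHom m) (M : ℝ),
    (∀ (y : Body) (v : Fibre m), ‖v‖ = 1 → |f.1 (y, v)| ≤ M) → |L f| ≤ C * M
  positivity : ∀ f : CHom m, (∀ x, 0 ≤ f.1 x) → 0 ≤ L f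
  support : ∀ f : CHom m,
    (∀ (y : Body) (ξ : Fin m → ℝ × ℝ) (η : ℝ), 0 ≤ η → f.1 (y, (ξ, η)) = 0) → L f = 0
  projection : ∀ φ : C(Body, ℝ), L (CHom.eta φ) = ∫ y : Body, φ y

/-- A family of functionals `μ_{t_1 … t_m}` indexed by the finite sequences of times; only its
values at the sequences with `0 ≤ t_1 < ⋯ < t_m` are meaningful. -/
abbrev YoungFamily : Type := (m : ℕ) → (Fin m → ℝ) → (CHom m →ₗ[ℝ] ℝ)

/-- `μ` belongs to `SGY([0,+∞), [-1/2,1/2]; Ξ)`: it is a compatible system of generalized Young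
measures with time set `[0,+∞)`. -/
structure IsYoungSystem (μ : YoungFamily) : Prop where
  isGenYoungMeasure : ∀ (m : ℕ) (t : Fin m → ℝ), StrictMono t → (∀ i, 0 ≤ t i) →
    IsGenYoungMeasure (μ m t)
  compatible : ∀ (n m : ℕ) (s : Fin n → ℝ) (t : Fin m → ℝ) (ι : Fin n → Fin m),
    StrictMono s → StrictMono t → (∀ i, 0 ≤ t i) → (∀ i, s i = t (ι i)) →
    ∀ f : CHom n, μ n s f = μ m t (CHom.comap ι f)

/-- Weak* left continuity of a system of generalized Young measures. -/
def IsLeftContinuousSystem (μ : YoungFamily) : Prop :=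
  ∀ (m : ℕ) (t : Fin m → ℝ), StrictMono t → (∀ i, 0 ≤ t i) → ∀ f : CHom m,
    Tendsto (fun s => μ m s f) (𝓝[{s | StrictMono s ∧ ∀ i, 0 ≤ s i ∧ s i ≤ t i}] t)
      (𝓝 (μ m t f))

/-- A measure with respect to which the Lebesgue measure and all the `p i` and `z i` are absolutely
continuous. -/
def dominating {m : ℕ} (p z : Fin m → SignedMeasure Body) : Measure Body :=
  volume + ∑ i, ((p i).totalVariation + (z i).totalVariation)

/-- The generalized Young measure `δ_{((p_1,z_1),…,(p_m,z_m))}` associated with measures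
`p_i, z_i ∈ M_b([-1/2,1/2])`: with `Λ = dominating p z`,
`⟨f, δ⟩ = ∫ f(y, (dp_i/dΛ, dz_i/dΛ)_i, d𝓛/dΛ) dΛ`. -/
def delta {m : ℕ} (p z : Fin m → SignedMeasure Body) (f : CHom m) : ℝ :=
  ∫ y, f.1 (y, (fun i => ((p i).rnDeriv (dominating p z) y, (z i).rnDeriv (dominating p z) y),
    ((volume : Measure Body).rnDeriv (dominating p z) y).toReal)) ∂(dominating p z)

/-- The bounded measure with a given density with respect to the Lebesgue measure. -/
def ofDensity (g : Body → ℝ) : SignedMeasure Body :=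
  (volume : Measure Body).withDensityᵥ g

/-! ### Approximable quasistatic evolutions -/

/-- `(u, e, μ)` is an approximable quasistatic evolution of the one-dimensional problem.
Measurability in time of `u` and `e` need not be required: it follows from left continuity. -/
structure IsApproximableEvolution (G : ℝ) (K : Set (ℝ × ℝ)) (V : ℝ → ℝ) (w : ℝ → ℝ → ℝ)
    (u₀ e₀ p₀ z₀ : Body → ℝ)
    (u : ℝ → BVFun) (e : ℝ → L2) (μ : YoungFamily) : Prop where
  bounded_u : ∀ T > 0, ∃ C : NNReal, ∀ᵐ t ∂(volume.restrict (Icc (0 : ℝ) T)),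
    ENNReal.ofReal ‖(u t).val‖ + (u t).grad.totalVariation univ ≤ C
  bounded_e : ∀ T > 0, ∃ C : ℝ, ∀ᵐ t ∂(volume.restrict (Icc (0 : ℝ) T)), ‖e t‖ ≤ C
  system : IsYoungSystem μ
  left_continuous_u : ∀ t ≥ 0, TendstoBV (𝓝[Icc 0 t] t) (fun s => (u s).val)
    (fun s => (u s).grad) (u t).val (u t).grad
  left_continuous_e : ∀ t ≥ 0, TendstoL2 (𝓝[Icc 0 t] t) e (e t)
  left_continuous_system : IsLeftContinuousSystem μ
  approximable : ∃ (ε : ℕ → ℝ) (Θ : Set ℝ) (uε : ℕ → ℝ → H1Fun) (eε pε zε : ℕ → ℝ → L2),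
    (∀ k, 0 < ε k) ∧ Tendsto ε atTop (𝓝 0) ∧
    Θ ⊆ Ici 0 ∧ 0 ∈ Θ ∧ volume (Ici (0 : ℝ) \ Θ) = 0 ∧
    (∀ k, IsRegularizedEvolution G K V w u₀ e₀ p₀ z₀ (ε k) (uε k) (eε k) (pε k) (zε k)) ∧
    (∀ t ∈ Θ, TendstoBV atTop (fun k => (uε k t).val) (fun k => ofDensity (uε k t).grad)
      (u t).val (u t).grad) ∧
    (∀ t ∈ Θ, TendstoL2 atTop (fun k => eε k t) (e t)) ∧
    (∀ (m : ℕ) (t : Fin m → ℝ), StrictMono t → (∀ i, t i ∈ Θ) → ∀ f : CHom m,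
      Tendsto (fun k => delta (fun i => ofDensity (pε k (t i))) (fun i => ofDensity (zε k (t i))) f)
        atTop (𝓝 (μ m t f)))

/-! ### Dissipation and energy -/

/-- The sums whose supremum is the dissipation `𝓓_H(μ; a, b)`: `t` ranges over the subdivisions
`a = t_0 < ⋯ < t_k = b`, and `f i` is the function `H(ξ_i - ξ_{i-1}, θ_i - θ_{i-1})`. -/
def dissipationSums (K : Set (ℝ × ℝ)) (μ : YoungFamily) (a b : ℝ) : Set ℝ :=
  {S | ∃ (k : ℕ) (t : Fin (k + 1) → ℝ) (f : Fin k → CHom (k + 1)),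
    StrictMono t ∧ t 0 = a ∧ t (Fin.last k) = b ∧
    (∀ (i : Fin k) (y : Body) (ξ : Fin (k + 1) → ℝ × ℝ) (η : ℝ),
      (f i).1 (y, (ξ, η)) = supportFunction K (ξ i.succ - ξ i.castSucc)) ∧
    S = ∑ i, μ (k + 1) t (f i)}

/-- The dissipation `𝓓_H(μ; a, b)`. -/
def dissipation (K : Set (ℝ × ℝ)) (μ : YoungFamily) (a b : ℝ) : ℝ :=
  sSup (dissipationSums K μ a b)

/-- The recession function `V^∞(θ) = lim_{s → +∞} V(s θ) / s`. -/
def recession (V : ℝ → ℝ) (θ : ℝ) : ℝ :=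
  limUnder atTop (fun s : ℝ => V (s * θ) / s)

open Classical in
/-- The homogeneous function `{V}(θ, η)`. -/
def homogenized (V : ℝ → ℝ) (θ η : ℝ) : ℝ :=
  if 0 < η then η * V (θ / η) else recession V θ

/-- The stored elastic energy `𝓠(e)` for `ℂ ξ = 2 G ξ`. -/
def elasticEnergy (G : ℝ) (e : Body → ℝ) : ℝ :=
  ∫ y : Body, (1 / 2) * (2 * G * e y) * e y

/-- The work `∫_0^T ⟨σ(t), D ẇ(t)⟩ dt` of the stress `σ = 2 G e` in the loading `w`. -/
def externalWork (G : ℝ) (w : ℝ → ℝ → ℝ) (e : ℝ → L2) (T : ℝ) : ℝ :=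
  ∫ t in (0 : ℝ)..T, ∫ y : Body,
    (2 * G * e t y) * deriv (fun x => deriv (fun s => w s x) t) y

end ShearBand

end

/-!
The regularized stress is constant in space, since it is divergence free in dimension one; the
boundary condition gives its value `s(t) = t - ∫ p(t)`. As `|V'| ≤ 1`, nothing flows while `s ≤ 1`,
so that `s ≥ t ∧ 1`; and the flow rule makes `p` and `z` nondecreasing in time. The yield condition
`s - V'(z) > 2` can hold for `s` slightly above `1` only where `z` is almost `1` or larger. Near the
origin this is the case from the start, and the flow there, of rate `1/ε`, keeps the stress below `1 + δ`
as soon as `ε` is small (`IsReducedFlow.stress_le`). At distance `r` from the origin one has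
`-V'(z₀) ≤ 1 - δ` for some `δ > 0`, so that no plastic strain ever develops there
(`IsReducedFlow.p_eq_zero`). On the side `α + ζ = 2` of the elastic domain the rates of `p` and `z`
coincide, hence `z = z₀ + p` (`IsReducedFlow.z_eq_add_p`). These facts are collected in
`exists_localization`. To avoid choosing representatives in `(t, y)`, the comparisons at almost every
point `y` are carried out in the Banach lattice `L²`, by the Gronwall type lemma
`Lp_nonpos_of_deriv_le`.

In the limit, `s → t ∧ 1`, while `p` is nonnegative, concentrates at the origin and has mass tending
to `(t - 1)⁺`. This determines `u`, through the primitive of `s + p`, and `μ_t`, by the continuity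
modulus of one-homogeneous functions (`tendsto_integral_concentrating`). For several times the limit
`μ_{t_0 … t_k}` is tested only with `H(ξ_i - ξ_{i-1}, θ_i - θ_{i-1})`, which is linear on the increments
that occur: both components are equal and nonnegative. So every dissipation sum telescopes to
`2 (T - 1)⁺`. All of this holds at almost every time, and left continuity extends it to all times
(`IsApproximableEvolution.limit`).
-/

namespace ShearBand

/-! ### Lebesgue measure on the body -/

theorem map_val_volume :
    (volume : Measure Body).map Subtype.val = volume.restrict (Icc (-(1 / 2) : ℝ) (1 / 2)) :=
  map_comap_subtype_coe measurableSet_Icc volume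

theorem measurableEmbedding_val : MeasurableEmbedding (Subtype.val : Body → ℝ) :=
  MeasurableEmbedding.subtype_coe measurableSet_Icc

theorem volume_body_apply (s : Set Body) : volume s = volume (Subtype.val '' s) :=
  measurableEmbedding_val.comap_apply _ _

instance : IsProbabilityMeasure (volume : Measure Body) := by
  constructor
  rw [volume_body_apply, image_univ, Subtype.range_coe]
  norm_num

instance : NullSingletonClass (volume : Measure Body) := by
  constructor
  intro y
  rw [volume_body_apply, image_singleton]
  exact measure_singleton _

instance : (volume : Measure Body).IsOpenPosMeasure := by
  constructor
  rintro U hU ⟨y, hy⟩ h0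
  rw [volume_body_apply] at h0
  obtain ⟨W, hW, rfl⟩ := isOpen_induced_iff.1 hU
  rw [Subtype.image_preimage_coe] at h0
  have hcl : (y : ℝ) ∈ closure (Ioo (-(1 / 2) : ℝ) (1 / 2)) := by
    rw [closure_Ioo (by norm_num)]
    exact y.2
  have hne := mem_closure_iff.1 hcl W hW hy
  have hpos := (hW.inter isOpen_Ioo).measure_pos volume hne
  refine hpos.ne' (measure_mono_null ?_ h0)
  exact fun x hx => ⟨Ioo_subset_Icc_self hx.2, hx.1⟩

theorem integral_body (f : ℝ → ℝ) :
    ∫ y : Body, f y = ∫ x in (-(1 / 2) : ℝ)..(1 / 2), f x := by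
  rw [intervalIntegral.integral_of_le (by norm_num), ← integral_Icc_eq_integral_Ioc]
  exact integral_subtype_comap measurableSet_Icc f

theorem setIntegral_body (f : ℝ → ℝ) (s : Set ℝ) (hs : MeasurableSet s) :
    ∫ y in ((Subtype.val : Body → ℝ) ⁻¹' s), f y =
      ∫ x in s ∩ Icc (-(1 / 2) : ℝ) (1 / 2), f x := by
  rw [← measurableEmbedding_val.setIntegral_map, map_val_volume, Measure.restrict_restrict hs]

theorem setIntegral_Iic_body (f : ℝ → ℝ) (a : Body) :
    ∫ y in Iic a, f y = ∫ x in (-(1 / 2) : ℝ)..a, f x := by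
  rw [intervalIntegral.integral_of_le a.2.1, ← integral_Icc_eq_integral_Ioc]
  have h := setIntegral_body f (Iic (a : ℝ)) measurableSet_Iic
  have h2 : Iic (a : ℝ) ∩ Icc (-(1 / 2) : ℝ) (1 / 2) = Icc (-(1 / 2) : ℝ) a := by
    ext x
    have := a.2.2
    simp only [mem_inter_iff, mem_Iic, mem_Icc]
    constructor
    · rintro ⟨h1, h2, h3⟩
      exact ⟨h2, h1⟩
    · rintro ⟨h1, h3⟩
      exact ⟨h3, h1, by linarith⟩
  rw [h2] at h
  exact h

theorem setIntegral_Ici_body (f : ℝ → ℝ) (a : Body) :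
    ∫ y in Ici a, f y = ∫ x in (a : ℝ)..(1 / 2), f x := by
  rw [intervalIntegral.integral_of_le a.2.2, ← integral_Icc_eq_integral_Ioc]
  have h := setIntegral_body f (Ici (a : ℝ)) measurableSet_Ici
  have h2 : Ici (a : ℝ) ∩ Icc (-(1 / 2) : ℝ) (1 / 2) = Icc (a : ℝ) (1 / 2) := by
    ext x
    have := a.2.1
    simp only [mem_inter_iff, mem_Ici, mem_Icc]
    constructor
    · rintro ⟨h1, h2, h3⟩
      exact ⟨h1, h3⟩
    · rintro ⟨h1, h3⟩
      exact ⟨h1, by linarith, h3⟩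
  rw [h2] at h
  exact h

theorem ae_ne_origin : ∀ᵐ y : Body, y ≠ origin := Measure.ae_ne _ _

/-! ### The du Bois-Reymond lemma and one-dimensional Sobolev functions -/

theorem IsTest.continuous {φ : ℝ → ℝ} (h : IsTest φ) : Continuous φ := h.1.continuous

theorem IsTest.continuous_deriv {φ : ℝ → ℝ} (h : IsTest φ) : Continuous (deriv φ) :=
  h.1.continuous_deriv (by simp)

theorem IsTest.eq_zero_of_notMem {φ : ℝ → ℝ} (h : IsTest φ) {x : ℝ}
    (hx : x ∉ Ioo (-(1 / 2) : ℝ) (1 / 2)) : φ x = 0 :=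
  image_eq_zero_of_notMem_tsupport fun hx' => hx (h.2.2 hx')

/-- The primitive of a test function of zero mean is a test function. -/
theorem IsTest.exists_primitive {χ : ℝ → ℝ} (h : IsTest χ)
    (h0 : ∫ x in (-(1 / 2) : ℝ)..(1 / 2), χ x = 0) : ∃ φ, IsTest φ ∧ deriv φ = χ := by
  have hc := h.continuous
  have hd : ∀ x, HasDerivAt (fun y => ∫ x in (-(1 / 2) : ℝ)..y, χ x) (χ x) x := fun x =>
    intervalIntegral.integral_hasDerivAt_right (hc.intervalIntegrable _ _)
      (hc.stronglyMeasurableAtFilter _ _) hc.continuousAt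
  have hderiv : deriv (fun y => ∫ x in (-(1 / 2) : ℝ)..y, χ x) = χ := funext fun x => (hd x).deriv
  obtain ⟨a, b, ha, hb, hab⟩ : ∃ a b : ℝ, -(1 / 2) < a ∧ b < 1 / 2 ∧ tsupport χ ⊆ Icc a b := by
    have hK : IsCompact (tsupport χ) := h.2.1
    rcases (tsupport χ).eq_empty_or_nonempty with he | hne
    · exact ⟨0, 0, by norm_num, by norm_num, by simp [he]⟩
    · obtain ⟨a, haK, ha⟩ := hK.exists_isLeast hne
      obtain ⟨b, hbK, hb⟩ := hK.exists_isGreatest hne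
      exact ⟨a, b, (h.2.2 haK).1, (h.2.2 hbK).2, fun x hx => ⟨ha hx, hb hx⟩⟩
  have hz : ∀ x, x ∉ Icc a b → χ x = 0 := fun x hx =>
    image_eq_zero_of_notMem_tsupport fun hx' => hx (hab hx')
  have hsupp : Function.support (fun y => ∫ x in (-(1 / 2) : ℝ)..y, χ x) ⊆ Icc a b := by
    intro y hy
    by_contra hyn
    apply hy
    rcases not_and_or.1 hyn with hya | hyb
    · push Not at hya
      refine intervalIntegral.integral_zero_ae (Eventually.of_forall fun x hx => hz x fun hx' => ?_)
      rcases mem_uIoc.1 hx with hx | hx <;> linarith [hx'.1, hx.2]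
    · push Not at hyb
      have h1 : ∫ x in y..(1 / 2), χ x = 0 := by
        refine intervalIntegral.integral_zero_ae
          (Eventually.of_forall fun x hx => hz x fun hx' => ?_)
        rcases mem_uIoc.1 hx with hx | hx <;> linarith [hx'.2, hx.1]
      have h2 := intervalIntegral.integral_add_adjacent_intervals
        (hc.intervalIntegrable (μ := volume) (-(1 / 2)) y) (hc.intervalIntegrable y (1 / 2))
      simp only
      linarith
  refine ⟨_, ⟨?_, ?_, ?_⟩, hderiv⟩
  · rw [contDiff_infty_iff_deriv]
    refine ⟨fun x => (hd x).differentiableAt, ?_⟩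
    rw [hderiv]
    exact h.1
  · exact HasCompactSupport.of_support_subset_isCompact isCompact_Icc hsupp
  · refine (closure_minimal hsupp isClosed_Icc).trans fun x hx => ⟨?_, ?_⟩ <;>
      linarith [hx.1, hx.2]

theorem exists_isTest_integral_eq_one :
    ∃ ψ, IsTest ψ ∧ ∫ x in (-(1 / 2) : ℝ)..(1 / 2), ψ x = 1 := by
  let b : ContDiffBump (0 : ℝ) := ⟨1 / 8, 1 / 4, by norm_num, by norm_num⟩
  have ht : tsupport (b.normed volume) ⊆ Ioo (-(1 / 2) : ℝ) (1 / 2) := by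
    rw [b.tsupport_normed_eq, Real.closedBall_eq_Icc]
    intro x hx
    constructor <;> norm_num [b] at hx ⊢ <;> linarith [hx.1, hx.2]
  refine ⟨b.normed volume, ⟨b.contDiff_normed, b.hasCompactSupport_normed, ht⟩, ?_⟩
  rw [intervalIntegral.integral_eq_integral_of_support_subset]
  · exact b.integral_normed
  · exact (subset_tsupport _).trans (ht.trans Ioo_subset_Ioc_self)

theorem integrable_mul_of_continuous {h : Body → ℝ} (hh : Integrable h) {ψ : ℝ → ℝ}
    (hψ : Continuous ψ) : Integrable (fun y : Body => h y * ψ y) := by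
  obtain ⟨C, hC⟩ := isCompact_Icc.exists_bound_of_continuousOn
    (hψ.continuousOn (s := Icc (-(1 / 2) : ℝ) (1 / 2)))
  exact hh.mul_bdd (c := C) (by fun_prop) (Eventually.of_forall fun y => hC y y.2)

theorem ae_eq_zero_of_forall_integral_isTest {h : Body → ℝ} (hh : Integrable h)
    (h0 : ∀ ψ, IsTest ψ → ∫ y : Body, h y * ψ y = 0) : ∀ᵐ y : Body, h y = 0 := by
  set g : ℝ → ℝ := fun x => h (projIcc (-(1 / 2)) (1 / 2) (by norm_num) x) with hg
  have hgy : ∀ y : Body, g y = h y := fun y => by simp [hg]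
  have hgi : IntegrableOn g (Icc (-(1 / 2)) (1 / 2)) := by
    rw [IntegrableOn, ← map_val_volume, measurableEmbedding_val.integrable_map_iff]
    exact hh.congr (Eventually.of_forall fun y => (hgy y).symm)
  have key := isOpen_Ioo.ae_eq_zero_of_integral_contDiff_smul_eq_zero (μ := volume)
    (f := g) (U := Ioo (-(1 / 2) : ℝ) (1 / 2))
    (hgi.mono_set Ioo_subset_Icc_self).locallyIntegrableOn (by
      intro ψ h1 h2 h3
      have h4 := h0 ψ ⟨h1, h2, h3⟩
      have h5 := integral_body (fun x => g x * ψ x)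
      simp only [hgy] at h5
      rw [h4, intervalIntegral.integral_eq_integral_of_support_subset] at h5
      · rw [h5]
        exact integral_congr_ae (Eventually.of_forall fun x => by simp [mul_comm])
      · intro x hx
        have : ψ x ≠ 0 := fun h => hx (by simp [h])
        exact Ioo_subset_Ioc_self (h3 (subset_tsupport _ this)))
  have key2 : ∀ᵐ x ∂(volume.restrict (Icc (-(1 / 2) : ℝ) (1 / 2))), g x = 0 := by
    rw [← restrict_Ioo_eq_restrict_Icc]
    exact (ae_restrict_iff' measurableSet_Ioo).2 key
  rw [← map_val_volume, measurableEmbedding_val.ae_map_iff] at key2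
  filter_upwards [key2] with y hy
  rw [← hgy, hy]

/-- The du Bois-Reymond lemma: a function with vanishing weak derivative is constant. -/
theorem ae_eq_const_of_forall_integral_deriv {h : Body → ℝ} (hh : Integrable h)
    (h0 : ∀ φ, IsTest φ → ∫ y : Body, h y * deriv φ y = 0) : ∃ c : ℝ, ∀ᵐ y : Body, h y = c := by
  obtain ⟨ψ₀, hψ₀, hψ₀1⟩ := exists_isTest_integral_eq_one
  refine ⟨∫ y : Body, h y * ψ₀ y, ?_⟩
  set c := ∫ y : Body, h y * ψ₀ y with hc
  -- A test function `ψ` of mean `m` differs from `m ψ₀` by the derivative of a test function.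
  have := ae_eq_zero_of_forall_integral_isTest (h := fun y => h y - c)
    (hh.sub (integrable_const c)) (by
      intro ψ hψ
      set m := ∫ x in (-(1 / 2) : ℝ)..(1 / 2), ψ x with hm
      have hχ : IsTest (fun x => ψ x - m * ψ₀ x) := by
        refine ⟨hψ.1.sub (contDiff_const.mul hψ₀.1), hψ.2.1.sub hψ₀.2.1.mul_left, ?_⟩
        refine (tsupport_sub _ _).trans (union_subset hψ.2.2 ?_)
        exact (tsupport_mul_subset_right).trans hψ₀.2.2
      obtain ⟨φ, hφ, hφd⟩ := hχ.exists_primitive (by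
        have hi := hψ₀.continuous.const_mul m
        rw [intervalIntegral.integral_sub (hψ.continuous.intervalIntegrable _ _)
          (hi.intervalIntegrable _ _),
          intervalIntegral.integral_const_mul, hψ₀1, hm]
        ring)
      have h1 := h0 φ hφ
      rw [hφd] at h1
      have h2 : ∫ y : Body, ψ y = m := integral_body ψ
      have i1 := integrable_mul_of_continuous hh hψ.continuous
      have i2 := integrable_mul_of_continuous hh hψ₀.continuous
      have i3 : Integrable (fun y : Body => c * ψ y) := by
        simpa using integrable_mul_of_continuous (integrable_const c) hψ.continuous
      have h3 : ∫ y : Body, h y * (ψ y - m * ψ₀ y) =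
          (∫ y : Body, h y * ψ y) - m * c := by
        rw [hc, ← integral_const_mul, ← integral_sub i1 (i2.const_mul m)]
        congr 1
        ext y
        ring
      have h4 : ∫ y : Body, (h y - c) * ψ y = (∫ y : Body, h y * ψ y) - c * m := by
        rw [← h2, ← integral_const_mul, ← integral_sub i1 i3]
        congr 1
        ext y
        ring
      rw [h4]
      linarith [h1, h3])
  filter_upwards [this] with y hy
  linarith

theorem integrable_L2 {α : Type*} [MeasurableSpace α] {ν : Measure α} [IsFiniteMeasure ν]
    (f : Lp ℝ 2 ν) : Integrable f ν :=
  (Lp.memLp f).integrable (by norm_num)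

/-- The primitive of `g` on the body that vanishes at the left end. -/
noncomputable def primitive (g : Body → ℝ) (y : Body) : ℝ := ∫ x in Iic y, g x

theorem continuous_primitive {g : Body → ℝ} (hg : Integrable g) : Continuous (primitive g) := by
  rw [continuous_iff_continuousAt]
  intro y
  have h : primitive g = fun y => ∫ x, (Iic y).indicator g x := by
    ext y
    rw [integral_indicator measurableSet_Iic, primitive]
  rw [h]
  refine tendsto_integral_filter_of_dominated_convergence (fun x => ‖g x‖)
    (Eventually.of_forall fun z => (hg.indicator measurableSet_Iic).aestronglyMeasurable)
    (Eventually.of_forall fun z => Eventually.of_forall fun x => norm_indicator_le_norm_self _ _)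
    hg.norm ?_
  have hne : ∀ᵐ x : Body, x ≠ y := Measure.ae_ne _ _
  filter_upwards [hne] with x hx
  rcases lt_or_gt_of_ne hx with hlt | hlt
  · refine tendsto_const_nhds.congr' ?_
    filter_upwards [lt_mem_nhds hlt] with z hz
    simp [indicator, hz.le, hlt.le]
  · refine tendsto_const_nhds.congr' ?_
    filter_upwards [gt_mem_nhds hlt] with z hz
    simp [indicator, hz.not_ge, hlt.not_ge]

/-- Integration by parts for a primitive, by Fubini's theorem. -/
theorem integral_primitive_mul_deriv {g : Body → ℝ} (hg : Integrable g) {φ : ℝ → ℝ}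
    (hφ : IsTest φ) : ∫ y : Body, primitive g y * deriv φ y = -∫ y : Body, g y * φ y := by
  have hd := hφ.continuous_deriv
  have hD : Integrable (fun y : Body => deriv φ y) := by
    simpa using integrable_mul_of_continuous (integrable_const (1 : ℝ)) hd
  have hI : Integrable (Function.uncurry fun y x : Body =>
      (Iic y).indicator (fun x => deriv φ y * g x) x) (volume.prod volume) := by
    have h1 : Integrable (fun q : Body × Body => deriv φ q.1 * g q.2) (volume.prod volume) :=
      hD.mul_prod hg
    have h2 := h1.indicator (s := {q : Body × Body | q.2 ≤ q.1})
      (measurableSet_le measurable_snd measurable_fst)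
    exact h2
  have hF := integral_integral_swap hI
  have hL : ∀ y : Body, ∫ x : Body, (Iic y).indicator (fun x => deriv φ y * g x) x =
      primitive g y * deriv φ y := by
    intro y
    rw [integral_indicator measurableSet_Iic, integral_const_mul, primitive, mul_comm]
  have hR : ∀ x : Body, ∫ y : Body, (Iic y).indicator (fun x => deriv φ y * g x) x =
      -(g x * φ x) := by
    intro x
    have : ∀ y : Body, (Iic y).indicator (fun x => deriv φ y * g x) x =
        (Ici x).indicator (fun y : Body => deriv φ y * g x) y := by
      intro y
      simp [indicator]
    simp only [this]
    rw [integral_indicator measurableSet_Ici, integral_mul_const, setIntegral_Ici_body,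
      intervalIntegral.integral_deriv_eq_sub'
        φ rfl (fun z _ => hφ.1.differentiable (by simp) z) hd.continuousOn,
      hφ.eq_zero_of_notMem (x := 1 / 2) (by simp)]
    ring
  simp only [hL, hR] at hF
  rw [hF, integral_neg]

/-- A Sobolev function with prescribed traces is the primitive of its weak derivative. -/
theorem H1Fun.eq_primitive (v : H1Fun) {a b : ℝ} (ha : HasTrace v leftEnd a)
    (hb : HasTrace v rightEnd b) :
    (∀ᵐ y : Body, v.val y = a + primitive v.grad y) ∧ ∫ y : Body, v.grad y = b - a := by
  have hgi := integrable_L2 v.grad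
  have hvi := integrable_L2 v.val
  have hpc := continuous_primitive hgi
  have hpi : Integrable (primitive v.grad) := hpc.integrable_of_hasCompactSupport
    (HasCompactSupport.of_compactSpace _)
  obtain ⟨c, hc⟩ := ae_eq_const_of_forall_integral_deriv (hvi.sub hpi) (by
    intro φ hφ
    have h1 := v.weak_deriv φ hφ
    have h2 := integral_primitive_mul_deriv hgi hφ
    have h3 := integral_sub (integrable_mul_of_continuous hvi hφ.continuous_deriv)
      (integrable_mul_of_continuous hpi hφ.continuous_deriv)
    rw [h1, h2, sub_self] at h3
    rw [← h3]
    congr 1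
    ext y
    simp [sub_mul])
  have hrep : ∀ v' : C(Body, ℝ), (∀ᵐ y : Body, v.val y = v' y) →
      ∀ y, v' y = c + primitive v.grad y := by
    intro v' hv'
    have hae : v' =ᵐ[volume] fun y => c + primitive v.grad y := by
      filter_upwards [hc, hv'] with y h1 h2
      simp only [Pi.sub_apply] at h1
      linarith
    exact congrFun ((Continuous.ae_eq_iff_eq volume v'.continuous (by fun_prop)).1 hae)
  have hl : primitive v.grad leftEnd = 0 := by
    have : Iic leftEnd = {leftEnd} := by
      ext y
      simp only [mem_Iic, mem_singleton_iff]
      exact ⟨fun h => le_antisymm h y.2.1, fun h => h.le⟩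
    rw [primitive, this]
    simp
  have hr : primitive v.grad rightEnd = ∫ y : Body, v.grad y := by
    have : Iic rightEnd = univ := eq_univ_of_forall fun y => y.2.2
    rw [primitive, this, setIntegral_univ]
  obtain ⟨v₁, h1, h1a⟩ := ha
  obtain ⟨v₂, h2, h2b⟩ := hb
  have e1 := hrep v₁ h1 leftEnd
  have e2 := hrep v₂ h2 rightEnd
  rw [hl, h1a] at e1
  rw [hr, h2b] at e2
  refine ⟨?_, by linarith⟩
  filter_upwards [hc] with y hy
  simp only [Pi.sub_apply] at hy
  linarith

/-! ### Projection onto the elastic domain -/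

/-- The elastic domain `{(α, ζ) : |α| + |ζ| ≤ 2}`. -/
def diamond : Set (ℝ × ℝ) := {q | |q.1| + |q.2| ≤ 2}

theorem mem_diamond_iff {q : ℝ × ℝ} : q ∈ diamond ↔ ∀ a b : ℝ, |a| ≤ 1 → |b| ≤ 1 →
    a * q.1 + b * q.2 ≤ 2 := by
  constructor
  · intro h a b ha hb
    have h1 : a * q.1 ≤ |q.1| := by
      calc a * q.1 ≤ |a * q.1| := le_abs_self _
        _ = |a| * |q.1| := abs_mul _ _
        _ ≤ 1 * |q.1| := by gcongr
        _ = |q.1| := one_mul _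
    have h2 : b * q.2 ≤ |q.2| := by
      calc b * q.2 ≤ |b * q.2| := le_abs_self _
        _ = |b| * |q.2| := abs_mul _ _
        _ ≤ 1 * |q.2| := by gcongr
        _ = |q.2| := one_mul _
    have : |q.1| + |q.2| ≤ 2 := h
    linarith
  · intro h
    have h1 := h 1 1 (by simp) (by simp)
    have h2 := h 1 (-1) (by simp) (by simp)
    have h3 := h (-1) 1 (by simp) (by simp)
    have h4 := h (-1) (-1) (by simp) (by simp)
    change |q.1| + |q.2| ≤ 2
    rcases abs_cases q.1 with ⟨e1, _⟩ | ⟨e1, _⟩ <;> rcases abs_cases q.2 with ⟨e2, _⟩ | ⟨e2, _⟩ <;>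
      rw [e1, e2] <;> linarith

/-- The variational inequality characterizes the projection. -/
theorem IsProjection.eq_of_forall_inner_nonpos {K : Set (ℝ × ℝ)} {x q k₀ : ℝ × ℝ}
    (h : IsProjection K x q) (hk₀ : k₀ ∈ K)
    (hv : ∀ k ∈ K, (x.1 - k₀.1) * (k.1 - k₀.1) + (x.2 - k₀.2) * (k.2 - k₀.2) ≤ 0) : q = k₀ := by
  have h1 := h.2 k₀ hk₀
  have h2 := hv q h.1
  have h3 : (q.1 - k₀.1) ^ 2 + (q.2 - k₀.2) ^ 2 ≤ 0 := by nlinarith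
  have h4 := sq_nonneg (q.1 - k₀.1)
  have h5 := sq_nonneg (q.2 - k₀.2)
  have h6 : q.1 - k₀.1 = 0 := pow_eq_zero_iff (two_ne_zero) |>.1 (by linarith)
  have h7 : q.2 - k₀.2 = 0 := pow_eq_zero_iff (two_ne_zero) |>.1 (by linarith)
  ext <;> linarith

theorem IsProjection.eq_self {K : Set (ℝ × ℝ)} {x q : ℝ × ℝ} (h : IsProjection K x q)
    (hx : x ∈ K) : q = x :=
  h.eq_of_forall_inner_nonpos hx fun k _ => by simp

theorem IsProjection.fst_le {s ζ : ℝ} {q : ℝ × ℝ} (h : IsProjection diamond (s, ζ) q)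
    (hs : 0 ≤ s) : q.1 ≤ s := by
  by_contra! hlt
  have hq : |q.1| + |q.2| ≤ 2 := h.1
  have h1 := h.2 (s, q.2) (by
    change |s| + |q.2| ≤ 2
    rw [abs_of_nonneg hs]
    rw [abs_of_pos (hs.trans_lt hlt)] at hq
    linarith)
  simp only at h1
  nlinarith

theorem IsProjection.le_fst {s ζ : ℝ} {q : ℝ × ℝ} (h : IsProjection diamond (s, ζ) q)
    (hs : s ≤ 0) : s ≤ q.1 := by
  by_contra! hlt
  have hq : |q.1| + |q.2| ≤ 2 := h.1
  have h1 := h.2 (s, q.2) (by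
    change |s| + |q.2| ≤ 2
    rw [abs_of_nonpos hs]
    rw [abs_of_neg (hlt.trans_le hs)] at hq
    linarith)
  simp only at h1
  nlinarith

theorem IsProjection.snd_le {s ζ : ℝ} {q : ℝ × ℝ} (h : IsProjection diamond (s, ζ) q) :
    q.2 ≤ max ζ 0 := by
  by_contra! hlt
  have h0 : 0 ≤ max ζ 0 := le_max_right _ _
  have hq : |q.1| + |q.2| ≤ 2 := h.1
  have h1 := h.2 (q.1, max ζ 0) (by
    change |q.1| + |max ζ 0| ≤ 2
    rw [abs_of_nonneg h0]
    rw [abs_of_pos (h0.trans_lt hlt)] at hq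
    linarith)
  simp only at h1
  nlinarith [le_max_left ζ 0]

theorem IsProjection.eq_edge {s ζ : ℝ} {q : ℝ × ℝ} (h : IsProjection diamond (s, ζ) q)
    (h1 : 2 ≤ s + ζ) (h2 : s - ζ ≤ 2) (h3 : ζ - s ≤ 2) :
    q = ((s - ζ + 2) / 2, (ζ - s + 2) / 2) := by
  apply h.eq_of_forall_inner_nonpos
  · change |(s - ζ + 2) / 2| + |(ζ - s + 2) / 2| ≤ 2
    rw [abs_of_nonneg (by linarith), abs_of_nonneg (by linarith)]
    linarith
  · intro k hk
    have := mem_diamond_iff.1 hk 1 1 (by simp) (by simp)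
    simp only
    nlinarith

theorem IsProjection.eq_vertex {s ζ : ℝ} {q : ℝ × ℝ} (h : IsProjection diamond (s, ζ) q)
    (h0 : 0 ≤ ζ) (h2 : 2 ≤ s - ζ) : q = (2, 0) := by
  apply h.eq_of_forall_inner_nonpos
  · change |(2 : ℝ)| + |(0 : ℝ)| ≤ 2
    norm_num
  · intro k hk
    have := mem_diamond_iff.1 hk 1 1 (by simp) (by simp)
    have := mem_diamond_iff.1 hk 1 0 (by simp) (by simp)
    simp only
    nlinarith

section Rate

variable {ε s ζ a b : ℝ}

theorem IsViscousRate.fst_nonneg (h : IsViscousRate ε diamond (s, ζ) (a, b)) (hε : 0 < ε)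
    (hs : 0 ≤ s) : 0 ≤ a := by
  obtain ⟨q, hq, hr⟩ := h
  have h1 := congrArg Prod.fst hr
  simp only [Prod.smul_fst, Prod.fst_sub, smul_eq_mul] at h1
  rw [h1]
  have := hq.fst_le hs
  exact mul_nonneg (by positivity) (by linarith)

theorem IsViscousRate.fst_nonpos (h : IsViscousRate ε diamond (s, ζ) (a, b)) (hε : 0 < ε)
    (hs : s ≤ 1) (hζ : |ζ| ≤ 1) : a ≤ 0 := by
  obtain ⟨q, hq, hr⟩ := h
  have h1 := congrArg Prod.fst hr
  simp only [Prod.smul_fst, Prod.fst_sub, smul_eq_mul] at h1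
  rw [h1]
  refine mul_nonpos_of_nonneg_of_nonpos (by positivity) ?_
  rcases le_total s 0 with h0 | h0
  · linarith [hq.le_fst h0]
  · have : q = (s, ζ) := hq.eq_self (by
      change |s| + |ζ| ≤ 2
      rw [abs_of_nonneg h0]
      linarith)
    simp [this]

theorem IsViscousRate.neg_snd_le (h : IsViscousRate ε diamond (s, ζ) (a, b)) (hε : 0 < ε) :
    -b ≤ ε⁻¹ * max (-ζ) 0 := by
  obtain ⟨q, hq, hr⟩ := h
  have h1 := congrArg Prod.snd hr
  simp only [Prod.smul_snd, Prod.snd_sub, smul_eq_mul] at h1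
  rw [h1, ← mul_neg]
  refine mul_le_mul_of_nonneg_left ?_ (by positivity)
  have := hq.snd_le
  rcases max_cases ζ 0 with h | h <;> rcases max_cases (-ζ) 0 with h' | h' <;> linarith

theorem IsViscousRate.le_fst (h : IsViscousRate ε diamond (s, ζ) (a, b)) (hε : 0 < ε)
    (hs : 0 ≤ s) (hζ : 0 ≤ ζ) (hζ1 : ζ ≤ 1) : ε⁻¹ * ((s + ζ - 2) / 2) ≤ a := by
  rcases le_total (s + ζ) 2 with h1 | h1
  · exact (mul_nonpos_of_nonneg_of_nonpos (by positivity) (by linarith)).trans (h.fst_nonneg hε hs)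
  obtain ⟨q, hq, hr⟩ := h
  have h2 := congrArg Prod.fst hr
  simp only [Prod.smul_fst, Prod.fst_sub, smul_eq_mul] at h2
  rw [h2]
  refine mul_le_mul_of_nonneg_left ?_ (by positivity)
  rcases le_total (s - ζ) 2 with h3 | h3
  · rw [hq.eq_edge h1 h3 (by linarith)]
    simp only
    linarith
  · rw [hq.eq_vertex hζ h3]
    simp only
    linarith

theorem IsViscousRate.fst_eq_snd (h : IsViscousRate ε diamond (s, ζ) (a, b)) (hε : 0 < ε)
    (hs : 0 ≤ s) (hs2 : s ≤ 2) (hζ : 0 ≤ ζ) (hζ1 : ζ ≤ 1) :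
    a = b ∧ b ≤ ε⁻¹ * max (s + ζ - 2) 0 := by
  obtain ⟨q, hq, hr⟩ := h
  have h2 := congrArg Prod.fst hr
  have h3 := congrArg Prod.snd hr
  simp only [Prod.smul_fst, Prod.fst_sub, Prod.smul_snd, Prod.snd_sub, smul_eq_mul] at h2 h3
  have hε' : 0 ≤ ε⁻¹ := by positivity
  rcases le_total (s + ζ) 2 with h1 | h1
  · have hqe : q = (s, ζ) := hq.eq_self (by
      change |s| + |ζ| ≤ 2
      rw [abs_of_nonneg hs, abs_of_nonneg hζ]
      linarith)
    rw [hqe] at h2 h3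
    simp only [sub_self, mul_zero] at h2 h3
    rw [h2, h3]
    exact ⟨rfl, mul_nonneg hε' (le_max_right _ _)⟩
  · have hqe := hq.eq_edge h1 (by linarith) (by linarith)
    rw [hqe] at h2 h3
    simp only at h2 h3
    rw [h2, h3]
    refine ⟨by ring, mul_le_mul_of_nonneg_left ?_ hε'⟩
    linarith [le_max_left (s + ζ - 2) 0]

end Rate

theorem isGreatest_support_diamond (v : ℝ × ℝ) :
    IsGreatest ((fun q : ℝ × ℝ => q.1 * v.1 + q.2 * v.2) '' diamond) (2 * max |v.1| |v.2|) := by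
  constructor
  · rcases le_total |v.2| |v.1| with h | h
    · refine ⟨(if 0 ≤ v.1 then 2 else -2, 0), ?_, ?_⟩
      · change |ite _ _ _| + |(0 : ℝ)| ≤ 2
        split_ifs <;> norm_num
      · rw [max_eq_left h]
        simp only
        split_ifs with h0
        · rw [abs_of_nonneg h0]
          ring
        · rw [abs_of_neg (not_le.1 h0)]
          ring
    · refine ⟨(0, if 0 ≤ v.2 then 2 else -2), ?_, ?_⟩
      · change |(0 : ℝ)| + |ite _ _ _| ≤ 2
        split_ifs <;> norm_num
      · rw [max_eq_right h]
        simp only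
        split_ifs with h0
        · rw [abs_of_nonneg h0]
          ring
        · rw [abs_of_neg (not_le.1 h0)]
          ring
  · rintro _ ⟨q, hq, rfl⟩
    have hq : |q.1| + |q.2| ≤ 2 := hq
    simp only
    set m := max |v.1| |v.2|
    have hm : 0 ≤ m := (abs_nonneg _).trans (le_max_left _ _)
    have h1 : q.1 * v.1 ≤ |q.1| * m :=
      (le_abs_self _).trans ((abs_mul _ _).trans_le (by gcongr; exact le_max_left _ _))
    have h2 : q.2 * v.2 ≤ |q.2| * m :=
      (le_abs_self _).trans ((abs_mul _ _).trans_le (by gcongr; exact le_max_right _ _))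
    nlinarith

theorem supportFunction_diamond (v : ℝ × ℝ) :
    supportFunction diamond v = 2 * max |v.1| |v.2| :=
  (isGreatest_support_diamond v).csSup_eq

/-! ### Comparison principles -/

/-- A function that does not increase while it lies above a nondecreasing barrier stays below the
barrier. -/
theorem le_of_barrier {g b : ℝ → ℝ} {h : ℝ → ℝ}
    (hg : ∀ T > 0, IntegrableOn g (Ioc 0 T)) (hh : ∀ t ≥ 0, h t = h 0 + ∫ s in (0 : ℝ)..t, g s)
    (hb : Monotone b) (hbc : Continuous b) (h0 : h 0 ≤ b 0)
    (hgb : ∀ᵐ t ∂(volume.restrict (Ioi (0 : ℝ))), b t < h t → g t ≤ 0) {t : ℝ} (ht : 0 ≤ t) :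
    h t ≤ b t := by
  by_contra! hlt
  have htpos : 0 < t := by
    rcases ht.eq_or_lt with rfl | h'
    · exact absurd h0 (not_le.2 hlt)
    · exact h'
  have hgi : ∀ r ∈ Icc 0 t, IntervalIntegrable g volume 0 r := by
    intro r hr
    rw [intervalIntegrable_iff_integrableOn_Ioc_of_le hr.1]
    exact (hg t htpos).mono_set (Ioc_subset_Ioc_right hr.2)
  have hcont : ContinuousOn h (Icc 0 t) := by
    have h1 : ContinuousOn (fun r => h 0 + ∫ s in (0 : ℝ)..r, g s) (Icc 0 t) := by
      refine continuousOn_const.add ?_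
      have := intervalIntegral.continuousOn_primitive_interval (μ := volume) (f := g) (a := 0)
        (b := t) (by rw [uIcc_of_le ht, integrableOn_Icc_iff_integrableOn_Ioc]; exact hg t htpos)
      rwa [uIcc_of_le ht] at this
    exact h1.congr fun r hr => hh r hr.1
  have hcl : IsCompact {r ∈ Icc 0 t | h r ≤ b r} :=
    isCompact_Icc.of_isClosed_subset
      (isClosed_Icc.isClosed_le hcont hbc.continuousOn) (fun r hr => hr.1)
  -- After the last time `r` at which `h ≤ b`, the function `h` does not increase.
  obtain ⟨r, ⟨hr, hrb⟩, hmax⟩ := hcl.exists_isGreatest ⟨0, ⟨le_rfl, ht⟩, h0⟩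
  have hle : ∫ s in r..t, g s ≤ 0 := by
    rw [intervalIntegral.integral_of_le hr.2]
    refine setIntegral_nonpos_of_ae_restrict ?_
    have h1 : ∀ᵐ s ∂(volume.restrict (Ioc r t)), b s < h s → g s ≤ 0 :=
      ae_restrict_of_ae_restrict_of_subset
        (fun s hs => lt_of_le_of_lt hr.1 hs.1) hgb
    filter_upwards [h1, ae_restrict_mem measurableSet_Ioc] with s hs hsm
    refine hs ?_
    by_contra! hcon
    exact absurd (hmax ⟨⟨hr.1.trans hsm.1.le, hsm.2⟩, hcon⟩) (not_le.2 hsm.1)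
  have h1 := intervalIntegral.integral_add_adjacent_intervals (hgi r hr)
    ((hgi r hr).symm.trans (hgi t ⟨ht, le_rfl⟩))
  have h2 := hh t ht
  have h3 := hh r hr.1
  have h4 := hb hr.2
  linarith

/-- Gronwall's lemma in integral form, with vanishing initial datum. -/
theorem eq_zero_of_le_integral {φ : ℝ → ℝ} {C T : ℝ}
    (hφ : ContinuousOn φ (Icc 0 T)) (h0 : ∀ t ∈ Icc 0 T, 0 ≤ φ t)
    (h : ∀ t ∈ Icc 0 T, φ t ≤ C * ∫ s in (0 : ℝ)..t, φ s) : ∀ t ∈ Icc 0 T, φ t = 0 := by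
  intro t ht
  have hT : 0 ≤ T := ht.1.trans ht.2
  have hint : ∀ r ∈ Icc 0 T, IntervalIntegrable φ volume 0 r := fun r hr =>
    (hφ.mono (by rw [uIcc_of_le hr.1]; exact Icc_subset_Icc_right hr.2)).intervalIntegrable
  have hnn : ∀ r ∈ Icc 0 T, 0 ≤ ∫ s in (0 : ℝ)..r, φ s := fun r hr =>
    intervalIntegral.integral_nonneg hr.1 fun s hs => h0 s ⟨hs.1, hs.2.trans hr.2⟩
  have hG : ∀ r ∈ Icc 0 T, ‖∫ s in (0 : ℝ)..r, φ s‖ ≤ gronwallBound 0 C 0 (r - 0) := by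
    refine norm_le_gronwallBound_of_norm_deriv_right_le (f' := φ) ?_ ?_ (by simp) ?_
    · have := intervalIntegral.continuousOn_primitive_interval (μ := volume) (f := φ) (a := 0)
        (b := T) (by rw [uIcc_of_le hT]; exact hφ.integrableOn_Icc)
      rwa [uIcc_of_le hT] at this
    · intro r hr
      have hrm : r ∈ Icc 0 T := ⟨hr.1, hr.2.le⟩
      have hmem : Icc 0 T ∈ 𝓝[Ici r] r :=
        mem_of_superset (Icc_mem_nhdsGE hr.2) (Icc_subset_Icc_left hr.1)
      have hmem' : Icc 0 T ∈ 𝓝[Ioi r] r := nhdsWithin_mono _ Ioi_subset_Ici_self hmem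
      exact intervalIntegral.integral_hasDerivWithinAt_right (hint r hrm)
        (s := Ici r) (t := Ioi r)
        ⟨Icc 0 T, hmem', hφ.aestronglyMeasurable measurableSet_Icc⟩
        (((hφ r hrm).mono_of_mem_nhdsWithin hmem').mono subset_rfl)
    · intro r hr
      have hrm : r ∈ Icc 0 T := ⟨hr.1, hr.2.le⟩
      rw [Real.norm_of_nonneg (h0 r hrm), Real.norm_of_nonneg (hnn r hrm), add_zero]
      exact h r hrm
  have h1 := hG t ht
  rw [gronwallBound_ε0_δ0] at h1
  have h2 := h t ht
  rw [norm_le_zero_iff.1 h1, mul_zero] at h2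
  exact le_antisymm h2 (h0 t ht)

instance {α : Type*} [MeasurableSpace α] {ν : Measure α} : IsOrderedModule ℝ (Lp ℝ 2 ν) := by
  refine IsOrderedModule.of_smul_nonneg fun a ha f hf => ?_
  rw [← Lp.coeFn_nonneg] at hf ⊢
  filter_upwards [hf, Lp.coeFn_smul a f] with x h1 h2
  rw [h2]
  exact mul_nonneg ha h1

/-- Comparison with zero for a differential inequality in the Banach lattice `L²`. It replaces the
comparison of the solutions at almost every point of the body. -/
theorem Lp_nonpos_of_deriv_le {α : Type*} [MeasurableSpace α] {ν : Measure α}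
    {h h' : ℝ → Lp ℝ 2 ν} {C : ℝ} (hC : 0 ≤ C)
    (hi : ∀ T > 0, IntegrableOn h' (Ioc 0 T)) (hh : ∀ t ≥ 0, h t = h 0 + ∫ s in (0 : ℝ)..t, h' s)
    (h0 : h 0 ≤ 0) (hle : ∀ᵐ t ∂(volume.restrict (Ioi (0 : ℝ))), h' t ≤ C • (h t ⊔ 0))
    {t : ℝ} (ht : 0 ≤ t) : h t ≤ 0 := by
  rcases ht.eq_or_lt with rfl | htpos
  · exact h0
  have hcont : ContinuousOn h (Icc 0 t) := by
    have h1 : ContinuousOn (fun r => h 0 + ∫ s in (0 : ℝ)..r, h' s) (Icc 0 t) := by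
      refine continuousOn_const.add ?_
      have := intervalIntegral.continuousOn_primitive_interval (μ := volume) (f := h') (a := 0)
        (b := t) (by rw [uIcc_of_le ht, integrableOn_Icc_iff_integrableOn_Ioc]; exact hi t htpos)
      rwa [uIcc_of_le ht] at this
    exact h1.congr fun r hr => hh r hr.1
  have hcp : ContinuousOn (fun r => h r ⊔ 0) (Icc 0 t) := hcont.sup continuousOn_const
  -- The positive part `h ⊔ 0` satisfies Gronwall's integral inequality in the order of `L²`, hence
  -- its norm does so too.
  have key : ∀ r ∈ Icc 0 t, h r ⊔ 0 ≤ C • ∫ s in (0 : ℝ)..r, h s ⊔ 0 := by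
    intro r hr
    have hnn : (0 : Lp ℝ 2 ν) ≤ C • ∫ s in (0 : ℝ)..r, h s ⊔ 0 := by
      refine smul_nonneg hC ?_
      rw [intervalIntegral.integral_of_le hr.1]
      exact integral_nonneg fun s => le_sup_right
    refine sup_le ?_ hnn
    rw [hh r hr.1, ← intervalIntegral.integral_smul]
    refine (add_le_of_nonpos_left h0).trans ?_
    rw [intervalIntegral.integral_of_le hr.1, intervalIntegral.integral_of_le hr.1]
    refine integral_mono_ae ((hi t htpos).mono_set (Ioc_subset_Ioc_right hr.2)) ?_ ?_
    · refine Integrable.smul C ?_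
      exact ((hcp.mono (Icc_subset_Icc_right hr.2)).integrableOn_Icc).mono_set Ioc_subset_Icc_self
    · exact ae_restrict_of_ae_restrict_of_subset (fun s hs => hs.1) hle
  have hz := eq_zero_of_le_integral (φ := fun r => ‖h r ⊔ 0‖) hcp.norm
    (fun r _ => norm_nonneg _) (by
      intro r hr
      have h1 := norm_le_norm_of_abs_le_abs (a := h r ⊔ 0) (b := C • ∫ s in (0 : ℝ)..r, h s ⊔ 0) (by
        rw [abs_of_nonneg (le_sup_right : (0 : Lp ℝ 2 ν) ≤ h r ⊔ 0)]
        exact (key r hr).trans (le_abs_self _))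
      refine h1.trans ?_
      rw [norm_smul, Real.norm_of_nonneg hC]
      gcongr
      exact intervalIntegral.norm_integral_le_integral_norm hr.1) t ⟨ht, le_rfl⟩
  have hsup : h t ⊔ 0 = 0 := norm_eq_zero.1 hz
  exact sup_eq_right.1 hsup

/-! ### The softening potential -/

/-- The assumptions on the softening potential `V`. -/
structure IsSoftening (V : ℝ → ℝ) (M : ℝ) : Prop where
  contDiff : ContDiff ℝ 2 V
  le_deriv2 : ∀ θ, -M ≤ deriv (deriv V) θ
  deriv2_nonpos : ∀ θ, deriv (deriv V) θ ≤ 0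
  even : ∀ θ, V θ = V (-θ)
  deriv_eq_iff : ∀ θ, deriv V θ = -1 ↔ 1 ≤ θ

namespace IsSoftening

variable {V : ℝ → ℝ} {M : ℝ} (h : IsSoftening V M)
include h

theorem differentiable : Differentiable ℝ V := h.contDiff.differentiable (by norm_num)

theorem contDiff_deriv : ContDiff ℝ 1 (deriv V) := by
  have h2 : ContDiff ℝ (1 + 1) V := by
    have := h.contDiff
    norm_num
    exact this
  exact (contDiff_succ_iff_deriv.1 h2).2.2

theorem continuous_deriv : Continuous (deriv V) := h.contDiff_deriv.continuous

theorem antitone_deriv : Antitone (deriv V) :=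
  antitone_of_deriv_nonpos (h.contDiff_deriv.differentiable (by norm_num)) h.deriv2_nonpos

theorem deriv_neg (θ : ℝ) : deriv V (-θ) = -deriv V θ := by
  have h1 : V = fun θ => V (-θ) := funext h.even
  have h2 := deriv_comp_neg V θ
  rw [← h1] at h2
  linarith

theorem deriv_zero : deriv V 0 = 0 := by
  have := h.deriv_neg 0
  rw [neg_zero] at this
  linarith

theorem neg_one_le_deriv (θ : ℝ) : -1 ≤ deriv V θ := by
  have h1 := h.antitone_deriv (le_max_left θ 1)
  rw [(h.deriv_eq_iff _).2 (le_max_right θ 1)] at h1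
  exact h1

theorem deriv_le_one (θ : ℝ) : deriv V θ ≤ 1 := by
  have h1 := h.neg_one_le_deriv (-θ)
  rw [h.deriv_neg] at h1
  linarith

theorem deriv_nonpos {θ : ℝ} (hθ : 0 ≤ θ) : deriv V θ ≤ 0 :=
  h.deriv_zero ▸ h.antitone_deriv hθ

theorem neg_one_lt_deriv {θ : ℝ} (hθ : θ < 1) : -1 < deriv V θ :=
  lt_of_le_of_ne (h.neg_one_le_deriv θ) fun he => hθ.not_ge ((h.deriv_eq_iff θ).1 he.symm)

theorem nonneg : 0 ≤ M := by
  linarith [h.le_deriv2 0, h.deriv2_nonpos 0]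

theorem deriv_sub_le {a b : ℝ} (hab : a ≤ b) : deriv V a - deriv V b ≤ M * (b - a) := by
  have := (convex_univ (𝕜 := ℝ)).mul_sub_le_image_sub_of_le_deriv (f := deriv V)
    h.continuous_deriv.continuousOn
    (h.contDiff_deriv.differentiable (by norm_num)).differentiableOn
    (fun x _ => h.le_deriv2 x) a (mem_univ _) b (mem_univ _) hab
  linarith

end IsSoftening

/-! ### Curves in `L²` with a time derivative -/

namespace HasTimeDeriv

variable {f f' g g' : ℝ → L2}

theorem integrableOn (h : HasTimeDeriv f f') {T : ℝ} (hT : 0 < T) : IntegrableOn f' (Ioc 0 T) :=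
  (h.1 T hT).integrable (by norm_num)

theorem intervalIntegrable (h : HasTimeDeriv f f') {a b : ℝ} (ha : 0 ≤ a) (hab : a ≤ b) :
    IntervalIntegrable f' volume a b := by
  rw [intervalIntegrable_iff_integrableOn_Ioc_of_le hab]
  exact (h.integrableOn (T := b + 1) (by linarith)).mono_set
    (Ioc_subset_Ioc ha (by linarith))

theorem sub_eq (h : HasTimeDeriv f f') {a b : ℝ} (ha : 0 ≤ a) (hab : a ≤ b) :
    f b - f a = ∫ s in a..b, f' s := by
  rw [h.2 a ha, h.2 b (ha.trans hab), ← intervalIntegral.integral_add_adjacent_intervals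
    (h.intervalIntegrable le_rfl ha) (h.intervalIntegrable ha hab)]
  abel

theorem map {F : Type*} [NormedAddCommGroup F] [NormedSpace ℝ F] [CompleteSpace F]
    (h : HasTimeDeriv f f') (L : L2 →L[ℝ] F) :
    (∀ T > 0, IntegrableOn (fun t => L (f' t)) (Ioc 0 T)) ∧
      ∀ t ≥ 0, L (f t) = L (f 0) + ∫ s in (0 : ℝ)..t, L (f' s) := by
  refine ⟨fun T hT => L.integrable_comp (h.integrableOn hT), fun t ht => ?_⟩
  rw [L.intervalIntegral_comp_comm (h.intervalIntegrable le_rfl ht), ← map_add, ← h.2 t ht]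

theorem mono (h : HasTimeDeriv f f')
    (h0 : ∀ᵐ t ∂(volume.restrict (Ioi (0 : ℝ))), 0 ≤ f' t) {a b : ℝ} (ha : 0 ≤ a) (hab : a ≤ b) :
    f a ≤ f b := by
  rw [← sub_nonneg, h.sub_eq ha hab, intervalIntegral.integral_of_le hab]
  exact integral_nonneg_of_ae
    (ae_restrict_of_ae_restrict_of_subset (fun s hs => ha.trans_lt hs.1) h0)

end HasTimeDeriv

/-- Integration over the body, as a continuous linear functional on `L²`. -/
noncomputable def integralL2 : L2 →L[ℝ] ℝ :=
  innerSL ℝ (indicatorConstLp 2 MeasurableSet.univ (measure_ne_top volume univ) (1 : ℝ))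

theorem integralL2_apply (f : L2) : integralL2 f = ∫ y : Body, f y := by
  rw [integralL2, innerSL_apply_apply, L2.inner_indicatorConstLp_one, setIntegral_univ]

/-! ### Estimates for the regularized evolution -/

/-- The stress at time `t` when the boundary datum is `t y` and the plastic strain is `p`. -/
noncomputable def stress (p : ℝ → L2) (t : ℝ) : ℝ := t - ∫ y : Body, p t y

/-- The regularized evolution with the (spatially constant) elastic strain eliminated. -/
structure IsReducedFlow (V : ℝ → ℝ) (z₀ : Body → ℝ) (ε : ℝ) (p z p' z' : ℝ → L2) : Prop where
  deriv_p : HasTimeDeriv p p'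
  deriv_z : HasTimeDeriv z z'
  initial_p : p 0 = 0
  initial_z : ∀ᵐ y : Body, z 0 y = z₀ y
  rate : ∀ᵐ t ∂(volume.restrict (Ioi (0 : ℝ))), ∀ᵐ y : Body,
    IsViscousRate ε diamond (stress p t, -deriv V (z t y)) (p' t y, z' t y)

section Reduction

variable {V : ℝ → ℝ} {z₀ : Body → ℝ} {ε : ℝ} {u : ℝ → H1Fun} {e p z : ℝ → L2}

/-- In dimension one equilibrium makes the strain constant in space, and the boundary condition
determines its value. -/
theorem IsRegularizedEvolution.strain
    (h : IsRegularizedEvolution (1 / 2) diamond V (fun t y => t * y) (fun _ => 0) (fun _ => 0)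
      (fun _ => 0) z₀ ε u e p z) {t : ℝ} (ht : 0 ≤ t) :
    (∀ᵐ y : Body, e t y = stress p t) ∧ (∀ᵐ y : Body, (u t).grad y = stress p t + p t y) ∧
      ∀ᵐ y : Body, (u t).val y = -(t / 2) + primitive (u t).grad y := by
  rcases ht.eq_or_lt with rfl | ht
  · have hp : ∫ y : Body, p 0 y = 0 := by
      rw [integral_congr_ae h.initial_p, integral_zero]
    have hs : stress p 0 = 0 := by
      rw [stress, hp, sub_zero]
    have hg : ∀ᵐ y : Body, (u 0).grad y = 0 := by
      refine ae_eq_zero_of_forall_integral_isTest (integrable_L2 _) fun φ hφ => ?_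
      have h1 := (u 0).weak_deriv φ hφ
      have h2 : ∫ y : Body, (u 0).val y * deriv φ y = 0 := by
        refine integral_eq_zero_of_ae ?_
        filter_upwards [h.initial_u] with y hy
        simp [hy]
      linarith
    refine ⟨?_, ?_, ?_⟩
    · filter_upwards [h.initial_e] with y hy
      rw [hy, hs]
    · filter_upwards [hg, h.initial_p] with y h1 h2
      rw [h1, hs, h2, add_zero]
    · filter_upwards [h.initial_u] with y hy
      have : primitive (u 0).grad y = 0 :=
        integral_eq_zero_of_ae (ae_restrict_of_ae hg)
      rw [hy, this]
      simp
  · have hl := h.boundary t ht leftEnd (Or.inl rfl)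
    have hr := h.boundary t ht rightEnd (Or.inr rfl)
    obtain ⟨h1, h2⟩ := (u t).eq_primitive hl hr
    obtain ⟨c, hc⟩ := ae_eq_const_of_forall_integral_deriv (integrable_L2 (e t)) (by
      intro φ hφ
      simpa using h.equilibrium t ht φ hφ)
    have hg : ∀ᵐ y : Body, (u t).grad y = c + p t y := by
      rw [h.kinematic t ht]
      filter_upwards [Lp.coeFn_add (e t) (p t), hc] with y h3 h4
      rw [h3, Pi.add_apply, h4]
    have hcs : c = stress p t := by
      rw [integral_congr_ae hg, integral_add (integrable_const _) (integrable_L2 _)] at h2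
      simp only [integral_const, probReal_univ, one_smul, leftEnd, rightEnd] at h2
      rw [stress]
      linarith
    rw [← hcs]
    refine ⟨hc, hg, ?_⟩
    filter_upwards [h1] with y hy
    rw [hy]
    simp only [leftEnd]
    ring

theorem IsRegularizedEvolution.exists_isReducedFlow
    (h : IsRegularizedEvolution (1 / 2) diamond V (fun t y => t * y) (fun _ => 0) (fun _ => 0)
      (fun _ => 0) z₀ ε u e p z) : ∃ p' z', IsReducedFlow V z₀ ε p z p' z' := by
  obtain ⟨p', z', hp, hz, hr⟩ := h.flow_rule
  refine ⟨p', z', hp, hz, ?_, h.initial_z, ?_⟩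
  · refine Lp.ext ?_
    filter_upwards [h.initial_p, Lp.coeFn_zero ℝ 2 (volume : Measure Body)] with y h1 h2
    rw [h1, h2, Pi.zero_apply]
  · filter_upwards [hr, ae_restrict_mem measurableSet_Ioi] with t ht ht0
    filter_upwards [ht, (h.strain (le_of_lt ht0)).1] with y h1 h2
    rw [h2] at h1
    simpa using h1

end Reduction

namespace IsReducedFlow

variable {V : ℝ → ℝ} {M : ℝ} {z₀ : Body → ℝ} {ε : ℝ} {p z p' z' : ℝ → L2}

theorem integral_p (h : IsReducedFlow V z₀ ε p z p' z') :
    (∀ T > 0, IntegrableOn (fun t => ∫ y : Body, p' t y) (Ioc 0 T)) ∧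
      ∀ t ≥ 0, ∫ y : Body, p t y = ∫ s in (0 : ℝ)..t, ∫ y : Body, p' s y := by
  have h1 := h.deriv_p.map integralL2
  simp only [integralL2_apply] at h1
  refine ⟨h1.1, fun t ht => ?_⟩
  rw [h1.2 t ht, h.initial_p, ← integralL2_apply, map_zero, zero_add]

theorem stress_zero (h : IsReducedFlow V z₀ ε p z p' z') : stress p 0 = 0 := by
  rw [stress, h.initial_p, ← integralL2_apply, map_zero, sub_zero]

/-- While the stress is at most `1` the state `(s, -V'(z))` is admissible, so the plastic strain does
not grow. -/
theorem integral_p_le (h : IsReducedFlow V z₀ ε p z p' z') (hV : IsSoftening V M) (hε : 0 < ε)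
    {t : ℝ} (ht : 0 ≤ t) : ∫ y : Body, p t y ≤ max (t - 1) 0 := by
  have h0 : ∫ y : Body, p 0 y = 0 := by
    rw [h.initial_p, ← integralL2_apply, map_zero]
  refine le_of_barrier (g := fun t => ∫ y : Body, p' t y) (b := fun t => max (t - 1) 0)
    (h := fun t => ∫ y : Body, p t y) h.integral_p.1 ?_ ?_ (by fun_prop) ?_ ?_ ht
  · intro t ht
    rw [h.integral_p.2 t ht, h0, zero_add]
  · intro a b hab
    exact max_le_max (by linarith) le_rfl
  · simp [h0]
  · filter_upwards [h.rate, ae_restrict_mem measurableSet_Ioi] with t hr ht0 hlt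
    refine integral_nonpos_of_ae ?_
    filter_upwards [hr] with y hy
    refine hy.fst_nonpos hε ?_ ?_
    · have := (le_max_left (t - 1) 0).trans_lt hlt
      rw [stress]
      linarith
    · rw [abs_neg, abs_le]
      exact ⟨hV.neg_one_le_deriv _, hV.deriv_le_one _⟩

theorem min_le_stress (h : IsReducedFlow V z₀ ε p z p' z') (hV : IsSoftening V M) (hε : 0 < ε)
    {t : ℝ} (ht : 0 ≤ t) : min t 1 ≤ stress p t := by
  have h1 := h.integral_p_le hV hε ht
  rw [stress]
  rcases max_cases (t - 1) 0 with h2 | h2 <;> rcases min_cases t 1 with h3 | h3 <;> linarith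

theorem stress_nonneg (h : IsReducedFlow V z₀ ε p z p' z') (hV : IsSoftening V M) (hε : 0 < ε)
    {t : ℝ} (ht : 0 ≤ t) : 0 ≤ stress p t :=
  (le_min ht zero_le_one).trans (h.min_le_stress hV hε ht)

theorem p_mono (h : IsReducedFlow V z₀ ε p z p' z') (hV : IsSoftening V M) (hε : 0 < ε)
    {a b : ℝ} (ha : 0 ≤ a) (hab : a ≤ b) : p a ≤ p b := by
  refine h.deriv_p.mono ?_ ha hab
  filter_upwards [h.rate, ae_restrict_mem measurableSet_Ioi] with t hr ht0
  rw [← Lp.coeFn_nonneg]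
  filter_upwards [hr] with y hy
  exact hy.fst_nonneg hε (h.stress_nonneg hV hε (le_of_lt ht0))

theorem p_nonneg (h : IsReducedFlow V z₀ ε p z p' z') (hV : IsSoftening V M) (hε : 0 < ε)
    {t : ℝ} (ht : 0 ≤ t) : 0 ≤ p t :=
  h.initial_p ▸ h.p_mono hV hε le_rfl ht

/-- For negative `z` the flow rule decreases `z`, but at a rate at most `(M / ε) |z|`, so that `z`
cannot become negative. -/
theorem z_nonneg (h : IsReducedFlow V z₀ ε p z p' z') (hV : IsSoftening V M) (hε : 0 < ε)
    (hz₀ : ∀ y, 0 ≤ z₀ y) {t : ℝ} (ht : 0 ≤ t) : 0 ≤ z t := by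
  have hm := h.deriv_z.map (-ContinuousLinearMap.id ℝ L2)
  simp only [neg_apply, ContinuousLinearMap.id_apply] at hm
  rw [← neg_nonpos]
  refine Lp_nonpos_of_deriv_le (h := fun t => -z t) (h' := fun t => -z' t) (C := ε⁻¹ * M)
    (mul_nonneg (by positivity) hV.nonneg) hm.1 hm.2 ?_ ?_ ht
  · rw [neg_nonpos, ← Lp.coeFn_nonneg]
    filter_upwards [h.initial_z] with y hy
    rw [hy]
    exact hz₀ y
  · filter_upwards [h.rate] with t hr
    rw [← Lp.coeFn_le]
    filter_upwards [hr, Lp.coeFn_neg (z' t), Lp.coeFn_smul (ε⁻¹ * M) (-z t ⊔ 0),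
      Lp.coeFn_sup (-z t) 0, Lp.coeFn_neg (z t), Lp.coeFn_zero ℝ 2 (volume : Measure Body)]
      with y hy h1 h2 h3 h4 h5
    rw [h1, h2, Pi.neg_apply, Pi.smul_apply, h3, Pi.sup_apply, h4, h5, Pi.neg_apply, Pi.zero_apply,
      smul_eq_mul, mul_assoc]
    refine (hy.neg_snd_le hε).trans (mul_le_mul_of_nonneg_left ?_ (by positivity))
    rw [neg_neg]
    rcases le_total 0 (z t y) with hz | hz
    · rw [max_eq_right (hV.deriv_nonpos hz)]
      exact mul_nonneg hV.nonneg le_sup_right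
    · have h6 := hV.deriv_sub_le hz
      rw [hV.deriv_zero, sub_zero, zero_sub] at h6
      exact max_le (h6.trans (mul_le_mul_of_nonneg_left le_sup_left hV.nonneg))
        (mul_nonneg hV.nonneg le_sup_right)

theorem zero_le_neg_deriv (h : IsReducedFlow V z₀ ε p z p' z') (hV : IsSoftening V M) (hε : 0 < ε)
    (hz₀ : ∀ y, 0 ≤ z₀ y) {t : ℝ} (ht : 0 ≤ t) : ∀ᵐ y : Body, 0 ≤ -deriv V (z t y) := by
  have := h.z_nonneg hV hε hz₀ ht
  rw [← Lp.coeFn_nonneg] at this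
  filter_upwards [this] with y hy
  linarith [hV.deriv_nonpos hy]

theorem initial_le_z (h : IsReducedFlow V z₀ ε p z p' z') (hV : IsSoftening V M) (hε : 0 < ε)
    (hz₀ : ∀ y, 0 ≤ z₀ y) {t : ℝ} (ht : 0 ≤ t) : ∀ᵐ y : Body, z₀ y ≤ z t y := by
  have hm : z 0 ≤ z t := by
    refine h.deriv_z.mono ?_ le_rfl ht
    filter_upwards [h.rate, ae_restrict_mem measurableSet_Ioi] with r hr hr0
    rw [← Lp.coeFn_nonneg]
    filter_upwards [hr, h.zero_le_neg_deriv hV hε hz₀ (le_of_lt hr0)] with y hy hζ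
    have := hy.neg_snd_le hε
    rw [max_eq_right (by linarith), mul_zero] at this
    simpa using this
  rw [← Lp.coeFn_le] at hm
  filter_upwards [hm, h.initial_z] with y h1 h2
  rwa [← h2]

/-- Where the softening variable is close to `1`, a stress above `1 + δ` produces plastic flow at a
rate of order `δ / ε`, so that for small `ε` the stress cannot grow beyond `1 + δ`. -/
theorem stress_le (h : IsReducedFlow V z₀ ε p z p' z') (hV : IsSoftening V M) (hε : 0 < ε)
    (hz₀ : ∀ y, 0 ≤ z₀ y) {δ : ℝ} (hδ : 0 < δ) {A : Set Body} (hA : MeasurableSet A)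
    (hzA : ∀ y ∈ A, 1 - δ / 2 ≤ -deriv V (z₀ y)) (hεA : ε ≤ δ / 4 * volume.real A) {t : ℝ}
    (ht : 0 ≤ t) : stress p t ≤ 1 + δ := by
  refine le_of_barrier (g := fun t => 1 - ∫ y : Body, p' t y) (b := fun _ => 1 + δ)
    (h := stress p) ?_ ?_ monotone_const continuous_const ?_ ?_ ht
  · intro T hT
    exact (integrable_const _).sub (h.integral_p.1 T hT)
  · intro t ht
    have hi : IntervalIntegrable (fun t => ∫ y : Body, p' t y) volume 0 t := by
      rw [intervalIntegrable_iff_integrableOn_Ioc_of_le ht]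
      exact (h.integral_p.1 (t + 1) (by linarith)).mono_set (Ioc_subset_Ioc_right (by linarith))
    rw [h.stress_zero, stress, h.integral_p.2 t ht, intervalIntegral.integral_sub (by simp) hi]
    simp
  · rw [h.stress_zero]
    linarith
  · filter_upwards [h.rate, ae_restrict_mem measurableSet_Ioi] with t hr ht0 hlt
    have ht0 : (0 : ℝ) ≤ t := le_of_lt ht0
    have hle : ∫ y : Body, A.indicator (fun _ => ε⁻¹ * (δ / 4)) y ≤ ∫ y : Body, p' t y := by
      refine integral_mono_ae ((integrable_const _).indicator hA) (integrable_L2 _) ?_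
      filter_upwards [hr, h.zero_le_neg_deriv hV hε hz₀ ht0, h.initial_le_z hV hε hz₀ ht0]
        with y hy hζ hz
      by_cases hyA : y ∈ A
      · rw [indicator_of_mem hyA]
        have hζ1 := hV.neg_one_le_deriv (z t y)
        refine le_trans ?_ (hy.le_fst hε (h.stress_nonneg hV hε ht0) hζ (by linarith))
        refine mul_le_mul_of_nonneg_left ?_ (by positivity)
        have := hzA y hyA
        have := hV.antitone_deriv hz
        linarith
      · rw [indicator_of_notMem hyA]
        exact hy.fst_nonneg hε (h.stress_nonneg hV hε ht0)
    rw [integral_indicator_const _ hA, smul_eq_mul] at hle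
    have : 1 ≤ volume.real A * (ε⁻¹ * (δ / 4)) := by
      have : volume.real A * (ε⁻¹ * (δ / 4)) = ε⁻¹ * (δ / 4 * volume.real A) := by ring
      rw [this, ← inv_mul_cancel₀ hε.ne']
      gcongr
    linarith

/-- As long as the stress is at most `2`, the flow takes place on the side `α + ζ = 2` of the
elastic domain and the increments of `p` and `z` coincide. -/
theorem z_eq_add_p (h : IsReducedFlow V z₀ ε p z p' z') (hV : IsSoftening V M) (hε : 0 < ε)
    (hz₀ : ∀ y, 0 ≤ z₀ y) (hs : ∀ t ≥ 0, stress p t ≤ 2) {t : ℝ}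
    (ht : 0 ≤ t) : ∀ᵐ y : Body, z t y = z₀ y + p t y := by
  have h1 : z t - z 0 = p t - p 0 := by
    rw [h.deriv_z.sub_eq le_rfl ht, h.deriv_p.sub_eq le_rfl ht,
      intervalIntegral.integral_of_le ht, intervalIntegral.integral_of_le ht]
    refine integral_congr_ae (ae_restrict_of_ae_restrict_of_subset (fun r hr => hr.1) ?_)
    filter_upwards [h.rate, ae_restrict_mem measurableSet_Ioi] with r hr hr0
    have hr0 : (0 : ℝ) ≤ r := le_of_lt hr0
    refine Lp.ext ?_
    filter_upwards [hr, h.zero_le_neg_deriv hV hε hz₀ hr0] with y hy hζ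
    have hζ1 := hV.neg_one_le_deriv (z r y)
    exact (hy.fst_eq_snd hε (h.stress_nonneg hV hε hr0) (hs r hr0) hζ (by linarith)).1.symm
  rw [h.initial_p, sub_zero] at h1
  have h2 : z t = z 0 + p t := by
    rw [← h1]
    abel
  rw [h2]
  filter_upwards [Lp.coeFn_add (z 0) (p t), h.initial_z] with y h3 h4
  rw [h3, Pi.add_apply, h4]

/-- No plastic strain develops where the yield condition fails by `δ` initially, if the stress
never exceeds `1 + δ`. -/
theorem p_eq_zero (h : IsReducedFlow V z₀ ε p z p' z') (hV : IsSoftening V M) (hε : 0 < ε)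
    (hz₀ : ∀ y, 0 ≤ z₀ y) {δ : ℝ} (hδ1 : δ ≤ 1) (hs : ∀ t ≥ 0, stress p t ≤ 1 + δ)
    {B : Set Body} (hB : MeasurableSet B) (hzB : ∀ y ∈ B, -deriv V (z₀ y) ≤ 1 - δ) {t : ℝ}
    (ht : 0 ≤ t) : ∀ᵐ y : Body, y ∈ B → p t y = 0 := by
  have hs2 : ∀ t ≥ 0, stress p t ≤ 2 := fun t ht => (hs t ht).trans (by linarith)
  -- On `B` the rate of `p = z - z₀` is at most `(M / ε) (z - z₀)`, which is compared with zero.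
  set R := LpToLpRestrictCLM Body ℝ ℝ volume 2 B with hR
  have hm := h.deriv_p.map R
  have key : R (p t) ≤ 0 := by
    refine Lp_nonpos_of_deriv_le (h := fun t => R (p t)) (h' := fun t => R (p' t)) (C := ε⁻¹ * M)
      (mul_nonneg (by positivity) hV.nonneg) hm.1 hm.2 ?_ ?_ ht
    · rw [h.initial_p, map_zero]
    · filter_upwards [h.rate, ae_restrict_mem measurableSet_Ioi] with r hr hr0
      have hr0 : (0 : ℝ) ≤ r := le_of_lt hr0
      rw [← Lp.coeFn_le]
      filter_upwards [ae_restrict_of_ae hr, LpToLpRestrictCLM_coeFn ℝ B (p' r),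
        LpToLpRestrictCLM_coeFn ℝ B (p r), Lp.coeFn_smul (ε⁻¹ * M) (R (p r) ⊔ 0),
        Lp.coeFn_sup (R (p r)) 0, ae_restrict_mem hB,
        ae_restrict_of_ae (h.zero_le_neg_deriv hV hε hz₀ hr0),
        ae_restrict_of_ae (h.z_eq_add_p hV hε hz₀ hs2 hr0),
        ae_restrict_of_ae (h.initial_le_z hV hε hz₀ hr0)] with y hy h1 h2 h3 h4 hyB hζ hz hzi
      rw [h1, h3, Pi.smul_apply, h4, Pi.sup_apply, h2, smul_eq_mul, mul_assoc]
      have hζ1 := hV.neg_one_le_deriv (z r y)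
      obtain ⟨h5, h6⟩ := hy.fst_eq_snd hε (h.stress_nonneg hV hε hr0) (hs2 r hr0) hζ (by linarith)
      rw [h5]
      refine h6.trans (mul_le_mul_of_nonneg_left ?_ (by positivity))
      have h7 := hV.deriv_sub_le hzi
      have h8 := hzB y hyB
      have h9 := hs r hr0
      have h10 : p r y = z r y - z₀ y := by linarith
      refine max_le (le_trans ?_ (mul_le_mul_of_nonneg_left le_sup_left hV.nonneg))
        (mul_nonneg hV.nonneg ?_)
      · rw [h10]
        linarith
      · refine le_trans ?_ le_sup_left
        linarith
  rw [← ae_restrict_iff' hB]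
  rw [← Lp.coeFn_le] at key
  have hp := h.p_nonneg hV hε ht
  rw [← Lp.coeFn_nonneg] at hp
  filter_upwards [key, LpToLpRestrictCLM_coeFn ℝ B (p t), ae_restrict_of_ae hp,
    Lp.coeFn_zero ℝ 2 (volume.restrict B)] with y h1 h2 h3 h4
  rw [h2, h4] at h1
  exact le_antisymm h1 h3

end IsReducedFlow

/-- Localization of the plastic strain: given `r > 0`, for `ε` small the plastic strain of every
regularized evolution vanishes at distance at least `r` from the origin, and the stress is within
`r` of `t ∧ 1`. -/
theorem exists_localization {V : ℝ → ℝ} {M : ℝ} (hV : IsSoftening V M) {z₀ : Body → ℝ}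
    (hz₀ : Continuous z₀) (hz₀_origin : z₀ origin = 1)
    (hz₀_ne : ∀ y, y ≠ origin → z₀ y < 1 ∧ 0 ≤ z₀ y) {r : ℝ} (hr : 0 < r) :
    ∃ ε₀ > 0, ∀ ε, 0 < ε → ε < ε₀ → ∀ p z p' z', IsReducedFlow V z₀ ε p z p' z' → ∀ t ≥ 0,
      (min t 1 ≤ stress p t ∧ stress p t ≤ min t 1 + r) ∧
      (∀ᵐ y : Body, z t y = z₀ y + p t y) ∧
      (∀ᵐ y : Body, r ≤ |(y : ℝ)| → p t y = 0) := by
  have hz₀n : ∀ y, 0 ≤ z₀ y := by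
    intro y
    by_cases hy : y = origin
    · rw [hy, hz₀_origin]
      exact zero_le_one
    · exact (hz₀_ne y hy).2
  have hc : Continuous fun y => deriv V (z₀ y) := hV.continuous_deriv.comp hz₀
  -- At distance at least `r` from the origin, `-V'(z₀)` stays away from `1` by compactness.
  obtain ⟨δ, hδ, hδ1, hδr, hδB⟩ : ∃ δ > 0, δ ≤ 1 ∧ δ ≤ r ∧
      ∀ y : Body, r ≤ |(y : ℝ)| → -deriv V (z₀ y) ≤ 1 - δ := by
    have hK : IsCompact {y : Body | r ≤ |(y : ℝ)|} :=
      (isClosed_le continuous_const (by fun_prop)).isCompact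
    rcases {y : Body | r ≤ |(y : ℝ)|}.eq_empty_or_nonempty with he | hne
    · refine ⟨min 1 r, by positivity, min_le_left _ _, min_le_right _ _, fun y hy => ?_⟩
      exact absurd (show y ∈ {y : Body | r ≤ |(y : ℝ)|} from hy) (by simp [he])
    · obtain ⟨y₁, hy₁, hmin⟩ := hK.exists_isMinOn hne hc.continuousOn
      have hlt : -1 < deriv V (z₀ y₁) := by
        refine hV.neg_one_lt_deriv (hz₀_ne y₁ ?_).1
        rintro rfl
        simp only [mem_ofPred_eq, origin, abs_zero] at hy₁
        linarith
      refine ⟨min (min 1 r) (deriv V (z₀ y₁) + 1), lt_min (by positivity) (by linarith),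
        (min_le_left _ _).trans (min_le_left _ _), (min_le_left _ _).trans (min_le_right _ _),
        fun y hy => ?_⟩
      have h1 : deriv V (z₀ y₁) ≤ deriv V (z₀ y) := hmin hy
      linarith [min_le_right (min 1 r) (deriv V (z₀ y₁) + 1)]
  -- The set where the yield condition holds at stress `1 + δ`, a neighbourhood of the origin.
  set A : Set Body := {y | 1 - δ / 2 < -deriv V (z₀ y)} with hA
  have hAo : IsOpen A := isOpen_lt continuous_const hc.neg
  have hAn : A.Nonempty := ⟨origin, by
    rw [hA, mem_ofPred_eq, hz₀_origin, (hV.deriv_eq_iff 1).2 le_rfl]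
    linarith⟩
  have hApos : 0 < volume.real A :=
    ENNReal.toReal_pos (hAo.measure_pos volume hAn).ne' (measure_ne_top _ _)
  refine ⟨δ / 4 * volume.real A, by positivity, ?_⟩
  intro ε hε hεlt p z p' z' h t ht
  have hs : ∀ t ≥ 0, stress p t ≤ 1 + δ := fun t ht =>
    h.stress_le hV hε hz₀n hδ hAo.measurableSet (fun y hy => le_of_lt hy) hεlt.le ht
  refine ⟨⟨h.min_le_stress hV hε ht, ?_⟩,
    h.z_eq_add_p hV hε hz₀n (fun t ht => (hs t ht).trans (by linarith)) ht,
    h.p_eq_zero hV hε hz₀n hδ1 hs (B := {y | r ≤ |(y : ℝ)|})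
      (isClosed_le continuous_const (by fun_prop)).measurableSet hδB ht⟩
  have h1 : 0 ≤ ∫ y : Body, p t y := by
    have := h.p_nonneg hV hε ht
    rw [← Lp.coeFn_nonneg] at this
    exact integral_nonneg_of_ae this
  have h2 := hs t ht
  rcases min_cases t 1 with h3 | h3
  · rw [h3.1, stress]
    linarith
  · rw [h3.1]
    linarith

/-! ### Generalized Young measures of Dirac type -/

instance {m : ℕ} (p z : Fin m → SignedMeasure Body) : IsFiniteMeasure (dominating p z) := by
  have h : ∀ q : SignedMeasure Body, IsFiniteMeasure q.totalVariation := fun q => by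
    rw [SignedMeasure.totalVariation]
    infer_instance
  have h2 : IsFiniteMeasure (∑ i, ((p i).totalVariation + (z i).totalVariation)) := by
    infer_instance
  rw [dominating]
  infer_instance

/-- The chain rule for the density of a signed measure. -/
theorem ae_eq_rnDeriv_mul {Λ ν : Measure Body} [IsFiniteMeasure Λ] [IsFiniteMeasure ν]
    (hΛ : Λ ≪ ν) {q : SignedMeasure Body} (hq : q.totalVariation ≪ Λ) {a : Body → ℝ}
    (ha : Integrable a ν) (hqa : q = ν.withDensityᵥ a) :
    ∀ᵐ y ∂ν, a y = (Λ.rnDeriv ν y).toReal * q.rnDeriv Λ y := by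
  have h1 : Λ.withDensityᵥ (q.rnDeriv Λ) = q := by
    rw [← SignedMeasure.absolutelyContinuous_iff_withDensityᵥ_rnDeriv_eq,
      SignedMeasure.absolutelyContinuous_ennreal_iff]
    simpa using hq
  have hi : Integrable (q.rnDeriv Λ) Λ := SignedMeasure.integrable_rnDeriv _ _
  have hi2 : Integrable (fun y => (Λ.rnDeriv ν y).toReal • q.rnDeriv Λ y) ν :=
    (integrable_rnDeriv_smul_iff hΛ).2 hi
  refine ha.ae_eq_of_forall_setIntegral_eq _ _ hi2 fun s hs _ => ?_
  have h2 := setIntegral_rnDeriv_smul hΛ (f := q.rnDeriv Λ) hs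
  simp only [smul_eq_mul] at h2
  rw [h2, ← withDensityᵥ_apply ha hs, ← hqa,
    ← withDensityᵥ_apply hi hs, h1]

/-- The functional `delta` may be computed with any reference measure in place of `dominating`, by
homogeneity. -/
theorem delta_eq_integral {m : ℕ} {p z : Fin m → SignedMeasure Body} (f : CHom m)
    (ν : Measure Body) [IsFiniteMeasure ν] {a b : Fin m → Body → ℝ} {c : Body → ENNReal}
    (hc : Measurable c) (ha : ∀ i, Integrable (a i) ν) (hb : ∀ i, Integrable (b i) ν)
    (hp : ∀ i, p i = ν.withDensityᵥ (a i)) (hz : ∀ i, z i = ν.withDensityᵥ (b i))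
    (hv : (volume : Measure Body) = ν.withDensity c) :
    delta p z f = ∫ y, f.1 (y, (fun i => (a i y, b i y), (c y).toReal)) ∂ν := by
  set Λ := dominating p z with hΛdef
  have hnull : ∀ s, Λ s = 0 ↔ volume s = 0 ∧
      ∀ i, (p i).totalVariation s = 0 ∧ (z i).totalVariation s = 0 := by
    intro s
    simp [hΛdef, dominating, Finset.sum_eq_zero_iff]
  have hpΛ : ∀ i, (p i).totalVariation ≪ Λ := fun i s hs => (((hnull s).1 hs).2 i).1
  have hzΛ : ∀ i, (z i).totalVariation ≪ Λ := fun i s hs => (((hnull s).1 hs).2 i).2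
  have hvΛ : (volume : Measure Body) ≪ Λ := fun s hs => ((hnull s).1 hs).1
  have htv : ∀ (q : SignedMeasure Body) (g : Body → ℝ), q = ν.withDensityᵥ g →
      q.totalVariation ≪ ν := by
    intro q g hq
    have := Measure.withDensityᵥ_absolutelyContinuous ν g
    rw [← hq, SignedMeasure.absolutelyContinuous_ennreal_iff] at this
    simpa using this
  have hΛ : Λ ≪ ν := by
    intro s hs
    refine (hnull s).2 ⟨?_, fun i => ⟨htv _ _ (hp i) hs, htv _ _ (hz i) hs⟩⟩
    rw [hv]
    exact withDensity_absolutelyContinuous _ _ hs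
  have h1 : ∀ᵐ y ∂ν, ∀ i, a i y = (Λ.rnDeriv ν y).toReal * (p i).rnDeriv Λ y :=
    ae_all_iff.2 fun i => ae_eq_rnDeriv_mul hΛ (hpΛ i) (ha i) (hp i)
  have h2 : ∀ᵐ y ∂ν, ∀ i, b i y = (Λ.rnDeriv ν y).toReal * (z i).rnDeriv Λ y :=
    ae_all_iff.2 fun i => ae_eq_rnDeriv_mul hΛ (hzΛ i) (hb i) (hz i)
  have h3 : ∀ᵐ y ∂ν, c y = (volume : Measure Body).rnDeriv Λ y * Λ.rnDeriv ν y := by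
    have h4 := Measure.rnDeriv_mul_rnDeriv (κ := ν) hvΛ
    have h5 := Measure.rnDeriv_withDensity ν hc
    rw [← hv] at h5
    filter_upwards [h4, h5] with y h6 h7
    rw [← h7, ← h6, Pi.mul_apply]
  rw [delta, ← hΛdef, ← integral_rnDeriv_smul hΛ]
  refine integral_congr_ae ?_
  filter_upwards [h1, h2, h3] with y h4 h5 h6
  rw [smul_eq_mul, ← f.2 y _ ENNReal.toReal_nonneg]
  congr 2
  refine Prod.ext (funext fun i => Prod.ext ?_ ?_) ?_
  · simp [h4 i]
  · simp [h5 i]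
  · simp [h6, mul_comm]

theorem ofDensity_eq (g : Body → ℝ) : ofDensity g = (volume : Measure Body).withDensityᵥ g := rfl

theorem delta_ofDensity {m : ℕ} (f : CHom m) {a b : Fin m → Body → ℝ}
    (ha : ∀ i, Integrable (a i)) (hb : ∀ i, Integrable (b i)) :
    delta (fun i => ofDensity (a i)) (fun i => ofDensity (b i)) f =
      ∫ y : Body, f.1 (y, (fun i => (a i y, b i y), 1)) := by
  have := delta_eq_integral (p := fun i => ofDensity (a i)) (z := fun i => ofDensity (b i)) f
    volume (c := fun _ => 1) measurable_const ha hb (fun _ => rfl) (fun _ => rfl)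
    (by simp)
  simpa using this

/-- The value of the generalized Young measure with an absolutely continuous part `z₀` and the
concentrated part `P (1, 1) δ₀`. -/
theorem delta_ofDensity_add_dirac (f : CHom 1) {z₀ : Body → ℝ} (hz₀ : Integrable z₀) {P : ℝ}
    (hP : 0 ≤ P)
    (hf : Integrable fun y : Body => f.1 (y, (fun _ => (0, z₀ y), 1))) :
    delta (fun _ => P • (Measure.dirac origin).toSignedMeasure)
      (fun _ => ofDensity z₀ + P • (Measure.dirac origin).toSignedMeasure) f =
      (∫ y : Body, f.1 (y, (fun _ => (0, z₀ y), 1))) + P * f.1 (origin, (fun _ => (1, 1), 0)) := by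
  -- With respect to `ν`, the Lebesgue measure and the Dirac mass live on complementary sets.
  set ν : Measure Body := volume + Measure.dirac origin with hν
  have hm : MeasurableSet ({origin} : Set Body) := measurableSet_singleton _
  have hvol : (volume : Measure Body) = ν.withDensity (({origin}ᶜ : Set Body).indicator 1) := by
    have h0 : (Measure.dirac origin).restrict ({origin}ᶜ : Set Body) = 0 := by
      rw [Measure.restrict_eq_zero]
      simp
    rw [withDensity_indicator_one hm.compl, hν, Measure.restrict_add, h0, add_zero]
    exact (Measure.restrict_eq_self_of_ae_mem ae_ne_origin).symm
  have hd : (Measure.dirac origin).toSignedMeasure =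
      ν.withDensityᵥ (({origin} : Set Body).indicator fun _ => (1 : ℝ)) := by
    ext s hs
    rw [withDensityᵥ_apply ((integrable_const _).indicator hm) hs,
      Measure.toSignedMeasure_apply_measurable hs, integral_indicator_const _ hm, smul_eq_mul,
      mul_one, measureReal_restrict_apply hm, hν, measureReal_add_apply]
    have h1 : (volume : Measure Body).real ({origin} ∩ s) = 0 := by
      rw [measureReal_def, measure_mono_null inter_subset_left (measure_singleton origin)]
      rfl
    rw [h1, zero_add]
    by_cases hs0 : origin ∈ s <;> simp [measureReal_def, hs0, hs]
  have hiz : Integrable (({origin}ᶜ : Set Body).indicator z₀) ν := by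
    rw [integrable_indicator_iff hm.compl, IntegrableOn, ← withDensity_indicator_one hm.compl,
      ← hvol]
    exact hz₀
  have hod : ofDensity z₀ = ν.withDensityᵥ (({origin}ᶜ : Set Body).indicator z₀) := by
    ext s hs
    rw [withDensityᵥ_apply hiz hs, ofDensity_eq, withDensityᵥ_apply hz₀ hs,
      setIntegral_indicator hm.compl]
    conv_lhs => rw [hvol, withDensity_indicator_one hm.compl, Measure.restrict_restrict hs]
  have hi1 : Integrable (({origin} : Set Body).indicator fun _ => (1 : ℝ)) ν :=
    (integrable_const _).indicator hm
  have hiP : Integrable (P • ({origin} : Set Body).indicator fun _ => (1 : ℝ)) ν := hi1.smul P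
  rw [delta_eq_integral f ν (c := ({origin}ᶜ : Set Body).indicator 1)
    (a := fun _ => P • ({origin} : Set Body).indicator fun _ => (1 : ℝ))
    (b := fun _ => ({origin}ᶜ : Set Body).indicator z₀ +
      P • ({origin} : Set Body).indicator fun _ => (1 : ℝ))
    (measurable_one.indicator hm.compl) (fun _ => hiP) (fun _ => hiz.add hiP)
    (fun _ => by rw [withDensityᵥ_smul, hd])
    (fun _ => by rw [withDensityᵥ_add hiz hiP, withDensityᵥ_smul, hd, hod]) hvol]
  have hae : (fun y : Body => f.1 (y, (fun _ : Fin 1 =>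
      ((P • ({origin} : Set Body).indicator fun _ => (1 : ℝ)) y,
        (({origin}ᶜ : Set Body).indicator z₀ +
          P • ({origin} : Set Body).indicator fun _ => (1 : ℝ)) y),
        (({origin}ᶜ : Set Body).indicator (1 : Body → ENNReal) y).toReal)))
      =ᵐ[volume] fun y => f.1 (y, (fun _ => (0, z₀ y), 1)) := by
    filter_upwards [ae_ne_origin] with y hy
    simp [hy]
  rw [hν, integral_add_measure (hf.congr hae.symm) (by
    exact integrable_dirac (by simp)), integral_congr_ae hae, integral_dirac, ← f.2 origin P hP]
  congr 3
  refine Prod.ext (funext fun i => Prod.ext ?_ ?_) ?_ <;> simp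

/-! ### Concentration of one-homogeneous functions -/

theorem CHom.exists_abs_le {m : ℕ} (f : CHom m) : ∃ C ≥ 0, ∀ y v, |f.1 (y, v)| ≤ C * ‖v‖ := by
  have hK : IsCompact ((univ : Set Body) ×ˢ Metric.closedBall (0 : Fibre m) 1) :=
    isCompact_univ.prod (isCompact_closedBall 0 1)
  obtain ⟨C, hC⟩ := hK.exists_bound_of_continuousOn f.1.continuous.continuousOn
  refine ⟨|C|, abs_nonneg _, fun y v => ?_⟩
  rcases eq_or_ne v 0 with rfl | hv
  · have := f.2 y 0 le_rfl 0
    simp only [smul_zero, zero_mul] at this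
    simp [this]
  · have hn : 0 < ‖v‖ := norm_pos_iff.2 hv
    have h1 := f.2 y ‖v‖ hn.le (‖v‖⁻¹ • v)
    rw [smul_inv_smul₀ hn.ne'] at h1
    have h2 := hC (y, ‖v‖⁻¹ • v) ⟨mem_univ _, by
      rw [mem_closedBall_zero_iff, norm_smul, norm_inv, norm_norm, inv_mul_cancel₀ hn.ne']⟩
    rw [h1, abs_mul, abs_of_pos hn, mul_comm]
    exact mul_le_mul_of_nonneg_right (h2.trans (le_abs_self C)) hn.le

/-- A one-homogeneous function has a modulus of continuity of the form `η (‖v‖ + ‖v'‖) + C ‖v - v'‖`,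
uniformly in nearby base points. -/
theorem CHom.exists_modulus {m : ℕ} (f : CHom m) {η : ℝ} (hη : 0 < η) (y₀ : Body) :
    ∃ ρ > 0, ∃ C ≥ 0, ∀ y v v', dist y y₀ < ρ →
      |f.1 (y, v) - f.1 (y₀, v')| ≤ η * (‖v‖ + ‖v'‖) + C * ‖v - v'‖ := by
  have hK : IsCompact ((univ : Set Body) ×ˢ Metric.closedBall (0 : Fibre m) 1) :=
    isCompact_univ.prod (isCompact_closedBall 0 1)
  have huc := hK.uniformContinuousOn_of_continuous f.1.continuous.continuousOn
  obtain ⟨ρ, hρ, huc⟩ := Metric.uniformContinuousOn_iff.1 huc η hη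
  obtain ⟨C, hC0, hC⟩ := CHom.exists_abs_le f
  refine ⟨ρ, hρ, 2 * C / ρ, by positivity, fun y v v' hy => ?_⟩
  set N := max ‖v‖ ‖v'‖ with hN
  have hN0 : 0 ≤ N := (norm_nonneg v).trans (le_max_left _ _)
  have hN2 : N ≤ ‖v‖ + ‖v'‖ :=
    max_le (le_add_of_nonneg_right (norm_nonneg _)) (le_add_of_nonneg_left (norm_nonneg _))
  -- Either `v` and `v'` are far apart relative to their size, or they are close after rescaling to
  -- the unit ball, where uniform continuity applies.
  rcases le_or_gt (ρ * N) ‖v - v'‖ with hbig | hsmall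
  · have h1 := hC y v
    have h2 := hC y₀ v'
    have h3 : |f.1 (y, v) - f.1 (y₀, v')| ≤ 2 * C * N := by
      refine (abs_sub _ _).trans ?_
      have h4 : C * ‖v‖ ≤ C * N := by gcongr; exact le_max_left _ _
      have h5 : C * ‖v'‖ ≤ C * N := by gcongr; exact le_max_right _ _
      linarith
    have h4 : 2 * C * N ≤ 2 * C / ρ * ‖v - v'‖ := by
      have : 2 * C * N = 2 * C / ρ * (ρ * N) := by field_simp
      rw [this]
      gcongr
    have h5 : 0 ≤ η * (‖v‖ + ‖v'‖) := by positivity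
    linarith
  · have hNpos : 0 < N := by
      by_contra! hcon
      have : N = 0 := le_antisymm hcon hN0
      rw [this, mul_zero] at hsmall
      have h1 : ‖v‖ ≤ 0 := this ▸ le_max_left _ _
      have h2 : ‖v'‖ ≤ 0 := this ▸ le_max_right _ _
      linarith [norm_nonneg (v - v')]
    have hball : ∀ x : Fibre m, ‖x‖ ≤ N → N⁻¹ • x ∈ Metric.closedBall (0 : Fibre m) 1 := by
      intro x hx
      rw [mem_closedBall_zero_iff, norm_smul, norm_inv, Real.norm_of_nonneg hN0,
        inv_mul_le_iff₀ hNpos, mul_one]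
      exact hx
    have hd : dist (N⁻¹ • v) (N⁻¹ • v') < ρ := by
      rw [dist_eq_norm, ← smul_sub, norm_smul, norm_inv, Real.norm_of_nonneg hN0,
        inv_mul_lt_iff₀ hNpos, mul_comm]
      exact hsmall
    have h1 := huc (y, N⁻¹ • v) ⟨mem_univ _, hball v (le_max_left _ _)⟩ (y₀, N⁻¹ • v')
      ⟨mem_univ _, hball v' (le_max_right _ _)⟩ (by rw [Prod.dist_eq]; exact max_lt hy hd)
    rw [Real.dist_eq] at h1
    have h2 := f.2 y N hN0 (N⁻¹ • v)
    have h3 := f.2 y₀ N hN0 (N⁻¹ • v')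
    rw [smul_inv_smul₀ hNpos.ne'] at h2 h3
    rw [h2, h3, ← mul_sub, abs_mul, abs_of_pos hNpos]
    have h4 : N * |f.1 (y, N⁻¹ • v) - f.1 (y₀, N⁻¹ • v')| ≤ N * η := by gcongr
    have h5 : N * η ≤ η * (‖v‖ + ‖v'‖) := by rw [mul_comm]; gcongr
    have h6 : 0 ≤ 2 * C / ρ * ‖v - v'‖ := by positivity
    linarith

theorem CHom.integrable_comp {m : ℕ} (f : CHom m) {a b : Fin m → Body → ℝ}
    (ha : ∀ i, Integrable (a i)) (hb : ∀ i, Integrable (b i)) :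
    Integrable fun y : Body => f.1 (y, (fun i => (a i y, b i y), 1)) := by
  obtain ⟨C, hC0, hC⟩ := CHom.exists_abs_le f
  have hm : AEStronglyMeasurable (fun y : Body => f.1 (y, (fun i => (a i y, b i y), 1))) := by
    refine f.1.continuous.comp_aestronglyMeasurable ?_
    refine aestronglyMeasurable_id.prodMk (AEStronglyMeasurable.prodMk ?_ aestronglyMeasurable_const)
    refine AEMeasurable.aestronglyMeasurable ?_
    exact aemeasurable_pi_lambda _ fun i =>
      (ha i).aestronglyMeasurable.aemeasurable.prodMk (hb i).aestronglyMeasurable.aemeasurable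
  refine Integrable.mono' (g := fun y => C * ((∑ i, (|a i y| + |b i y|)) + 1)) ?_ hm
    (Eventually.of_forall fun y => (hC _ _).trans ?_)
  · exact ((integrable_finsetSum _ fun i _ => (ha i).abs.add (hb i).abs).add
      (integrable_const _)).const_mul C
  · gcongr
    have hs : 0 ≤ ∑ i, (|a i y| + |b i y|) := Finset.sum_nonneg fun i _ => by positivity
    refine norm_prod_le_iff.2 ⟨(pi_norm_le_iff_of_nonneg (by positivity)).2 fun i => ?_, ?_⟩
    · have h1 := Finset.single_le_sum (f := fun i => |a i y| + |b i y|)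
        (fun i _ => by positivity) (Finset.mem_univ i)
      refine norm_prod_le_iff.2 ⟨?_, ?_⟩
      · simp only [Real.norm_eq_abs]
        linarith [abs_nonneg (b i y)]
      · simp only [Real.norm_eq_abs]
        linarith [abs_nonneg (a i y)]
    · simp only [norm_one]
      linarith

theorem tendsto_volume_ball_origin :
    Tendsto (fun r => (volume : Measure Body).real {y | |(y : ℝ)| < r}) (𝓝[>] 0) (𝓝 0) := by
  have h1 : ∀ᶠ r in 𝓝[>] (0 : ℝ), (volume : Measure Body).real {y | |(y : ℝ)| < r} ≤ 2 * r := by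
    filter_upwards [self_mem_nhdsWithin] with r hr
    have hr : (0 : ℝ) < r := hr
    refine ENNReal.toReal_le_of_le_ofReal (by positivity) ?_
    rw [volume_body_apply]
    refine (measure_mono (t := Ioo (-r) r) ?_).trans (by rw [Real.volume_Ioo]; gcongr; linarith)
    rintro _ ⟨y, hy, rfl⟩
    exact abs_lt.1 hy
  refine squeeze_zero' (Eventually.of_forall fun r => measureReal_nonneg) h1 ?_
  have : Tendsto (fun r : ℝ => 2 * r) (𝓝 0) (𝓝 (2 * 0)) := tendsto_id.const_mul 2
  rw [mul_zero] at this
  exact this.mono_left nhdsWithin_le_nhds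

/-- If nonnegative densities `p k` concentrate at the origin and their masses converge to `P`, the
Young measures of `(p k, z₀ + p k)` converge to that of `(P δ₀, z₀ + P δ₀)`. -/
theorem tendsto_integral_concentrating (f : CHom 1) {z₀ : Body → ℝ} (hz₀ : Continuous z₀)
    {p : ℕ → Body → ℝ} (hpi : ∀ k, Integrable (p k)) (hp0 : ∀ᶠ k in atTop, ∀ᵐ y : Body, 0 ≤ p k y)
    (hpr : ∀ r > 0, ∀ᶠ k in atTop, ∀ᵐ y : Body, r ≤ |(y : ℝ)| → p k y = 0) {P : ℝ}
    (hP : Tendsto (fun k => ∫ y : Body, p k y) atTop (𝓝 P)) :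
    Tendsto (fun k => ∫ y : Body, f.1 (y, (fun _ => (p k y, z₀ y + p k y), 1))) atTop
      (𝓝 ((∫ y : Body, f.1 (y, (fun _ => (0, z₀ y), 1))) +
        P * f.1 (origin, (fun _ => (1, 1), 0)))) := by
  have hz₀i : Integrable z₀ := hz₀.integrable_of_hasCompactSupport
    (HasCompactSupport.of_compactSpace _)
  set F := f.1 (origin, (fun _ => (1, 1), 0)) with hF
  have i1 : ∀ k, Integrable fun y : Body => f.1 (y, (fun _ => (p k y, z₀ y + p k y), 1)) :=
    fun k => CHom.integrable_comp f (a := fun _ => p k) (b := fun _ => z₀ + p k)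
      (fun _ => hpi k) (fun _ => hz₀i.add (hpi k))
  have i2 : Integrable fun y : Body => f.1 (y, (fun _ => (0, z₀ y), 1)) :=
    CHom.integrable_comp f (a := fun _ _ => 0) (b := fun _ => z₀)
      (fun _ => integrable_const _) (fun _ => hz₀i)
  -- The error `D k` vanishes at distance at least `r` from the origin; closer to it, `p k` may be
  -- large, but `(p k, z₀ + p k, 1)` and `p k • (1, 1, 0)` differ by a bounded vector.
  set D : ℕ → Body → ℝ := fun k y => f.1 (y, (fun _ => (p k y, z₀ y + p k y), 1)) -
    f.1 (y, (fun _ => (0, z₀ y), 1)) - p k y * F with hD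
  have iD : ∀ k, Integrable (D k) := fun k => ((i1 k).sub i2).sub ((hpi k).mul_const F)
  suffices hlim : Tendsto (fun k => ∫ y : Body, D k y) atTop (𝓝 0) by
    have h1 := (hlim.add (tendsto_const_nhds
      (x := ∫ y : Body, f.1 (y, (fun _ => (0, z₀ y), 1))))).add (hP.mul_const F)
    rw [zero_add] at h1
    refine h1.congr fun k => ?_
    have e1 : ∫ y : Body, D k y = (∫ y : Body, (f.1 (y, (fun _ => (p k y, z₀ y + p k y), 1)) -
        f.1 (y, (fun _ => (0, z₀ y), 1)))) - ∫ y : Body, p k y * F :=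
      integral_sub ((i1 k).sub i2) ((hpi k).mul_const F)
    rw [e1, integral_sub (i1 k) i2, integral_mul_const]
    ring
  obtain ⟨Z, hZ⟩ := isCompact_univ.exists_bound_of_continuousOn (hz₀.continuousOn (s := univ))
  have hZ : ∀ y, |z₀ y| ≤ Z := fun y => hZ y (mem_univ y)
  have hZ0 : 0 ≤ Z := (abs_nonneg _).trans (hZ origin)
  obtain ⟨C₁, hC₁0, hC₁⟩ := CHom.exists_abs_le f
  rw [Metric.tendsto_atTop']
  intro κ hκ
  have hP0 : 0 ≤ P := ge_of_tendsto hP (hp0.mono fun k hk => integral_nonneg_of_ae hk)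
  -- The constant makes `η ∫ (2 p k + Z + 1) ≤ κ / 2` once `∫ p k ≤ P + 1`.
  set η := κ / (2 * (2 * (P + 1) + Z + 1) + 1) with hη
  have hden : 0 < 2 * (2 * (P + 1) + Z + 1) + 1 := by positivity
  have hηpos : 0 < η := by positivity
  obtain ⟨ρ, hρ, C, hC0, hmod⟩ := CHom.exists_modulus f hηpos origin
  set C' := C * (Z + 1) + C₁ * (Z + 1) with hC'
  have hC'0 : 0 ≤ C' := by positivity
  obtain ⟨r, hr, hrρ, hrv⟩ : ∃ r > 0, r ≤ ρ ∧
      C' * (volume : Measure Body).real {y | |(y : ℝ)| < r} < κ / 2 := by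
    have h1 := tendsto_volume_ball_origin.const_mul C'
    rw [mul_zero] at h1
    have h2 := h1.eventually (gt_mem_nhds (half_pos hκ))
    have h3 : ∀ᶠ r in 𝓝[>] (0 : ℝ), r ≤ ρ := nhdsWithin_le_nhds (Iic_mem_nhds hρ)
    obtain ⟨r, ⟨h4, h5⟩, h6⟩ := ((h2.and h3).and self_mem_nhdsWithin).exists
    exact ⟨r, h6, h5, h4⟩
  set A : Set Body := {y | |(y : ℝ)| < r} with hA
  have hAm : MeasurableSet A :=
    (isOpen_lt (by fun_prop) continuous_const : IsOpen A).measurableSet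
  have hPk : ∀ᶠ k in atTop, ∫ y : Body, p k y < P + 1 := hP.eventually (gt_mem_nhds (by linarith))
  obtain ⟨k₀, hk₀⟩ := eventually_atTop.1 ((hp0.and (hpr r hr)).and hPk)
  refine ⟨k₀, fun k hk => ?_⟩
  obtain ⟨⟨h0, hr0⟩, hPk⟩ := hk₀ k hk.le
  rw [dist_zero_right]
  have hbound : ∀ᵐ y : Body, ‖D k y‖ ≤ η * (2 * p k y + Z + 1) + A.indicator (fun _ => C') y := by
    filter_upwards [h0, hr0] with y hy0 hyr
    by_cases hyA : y ∈ A
    · rw [indicator_of_mem hyA]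
      have hd : dist y origin < ρ := by
        rw [Subtype.dist_eq, Real.dist_eq]
        simp only [origin, sub_zero]
        exact lt_of_lt_of_le hyA hrρ
      have e1 := hmod y (fun _ => (p k y, z₀ y + p k y), 1) (fun _ => (p k y, p k y), 0) hd
      have e2 := f.2 origin (p k y) hy0 (fun _ => (1, 1), 0)
      have e3 : (p k y) • ((fun _ => (1, 1), 0) : Fibre 1) = (fun _ => (p k y, p k y), 0) := by
        ext <;> simp
      rw [e3, ← hF] at e2
      have e4 := hC₁ y (fun _ => (0, z₀ y), 1)
      have n1 : ‖((fun _ => (p k y, z₀ y + p k y), 1) : Fibre 1)‖ ≤ p k y + Z + 1 := by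
        refine norm_prod_le_iff.2 ⟨(pi_norm_le_iff_of_nonneg (by positivity)).2 fun i =>
          norm_prod_le_iff.2 ⟨?_, ?_⟩, ?_⟩ <;> simp only [Real.norm_eq_abs, abs_one]
        · rw [abs_of_nonneg hy0]
          linarith
        · refine (abs_add_le _ _).trans ?_
          rw [abs_of_nonneg hy0]
          linarith [hZ y]
        · linarith
      have n2 : ‖((fun _ => (p k y, p k y), 0) : Fibre 1)‖ ≤ p k y := by
        refine norm_prod_le_iff.2 ⟨(pi_norm_le_iff_of_nonneg hy0).2 fun i =>
          norm_prod_le_iff.2 ⟨?_, ?_⟩, ?_⟩ <;> simp [abs_of_nonneg hy0, hy0]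
      have n3 : ‖((fun _ => (0, z₀ y), 1) : Fibre 1)‖ ≤ Z + 1 := by
        refine norm_prod_le_iff.2 ⟨(pi_norm_le_iff_of_nonneg (by positivity)).2 fun i =>
          norm_prod_le_iff.2 ⟨?_, ?_⟩, ?_⟩ <;> simp only [Real.norm_eq_abs, abs_one, abs_zero]
        · positivity
        · linarith [hZ y]
        · linarith
      have n4 : ‖((fun _ => (p k y, z₀ y + p k y), 1) : Fibre 1) - (fun _ => (p k y, p k y), 0)‖
          ≤ Z + 1 := by
        have : ((fun _ => (p k y, z₀ y + p k y), 1) : Fibre 1) - (fun _ => (p k y, p k y), 0) =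
            (fun _ => (0, z₀ y), 1) := by
          ext <;> simp
        rw [this]
        exact n3
      have m1 : η * (‖((fun _ => (p k y, z₀ y + p k y), 1) : Fibre 1)‖ +
          ‖((fun _ => (p k y, p k y), 0) : Fibre 1)‖) ≤ η * (2 * p k y + Z + 1) := by
        exact mul_le_mul_of_nonneg_left (by linarith) hηpos.le
      have m2 := mul_le_mul_of_nonneg_left n4 hC0
      have m3 := mul_le_mul_of_nonneg_left n3 hC₁0
      rw [e2] at e1
      rw [Real.norm_eq_abs, hD]
      simp only
      have : ∀ x₁ x₂ x₃ : ℝ, |x₁ - x₂ - x₃| ≤ |x₁ - x₃| + |x₂| := fun x₁ x₂ x₃ => by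
        have := abs_sub (x₁ - x₃) x₂
        rwa [show x₁ - x₃ - x₂ = x₁ - x₂ - x₃ by ring] at this
      refine (this _ _ _).trans ?_
      linarith
    · rw [indicator_of_notMem hyA, add_zero]
      have h1 : p k y = 0 := hyr (not_lt.1 hyA)
      have h2 : D k y = 0 := by
        rw [hD]
        simp [h1]
      rw [h2, h1, norm_zero]
      positivity
  have hgi : Integrable fun y : Body => η * (2 * p k y + Z + 1) :=
    ((((hpi k).const_mul 2).add (integrable_const Z)).add (integrable_const 1)).const_mul η
  calc ‖∫ y : Body, D k y‖ ≤ ∫ y : Body, ‖D k y‖ := norm_integral_le_integral_norm _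
    _ ≤ ∫ y : Body, (η * (2 * p k y + Z + 1) + A.indicator (fun _ => C') y) :=
      integral_mono_ae (iD k).norm (hgi.add ((integrable_const _).indicator hAm)) hbound
    _ = η * (2 * (∫ y : Body, p k y) + Z + 1) + C' * (volume : Measure Body).real A := by
      rw [integral_add hgi ((integrable_const _).indicator hAm), integral_indicator_const _ hAm,
        integral_const_mul]
      have e1 : ∫ y : Body, (2 * p k y + Z + 1) = (∫ y : Body, (2 * p k y + Z)) + ∫ _ : Body, 1 :=
        integral_add (((hpi k).const_mul 2).add (integrable_const Z)) (integrable_const 1)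
      rw [e1, integral_add ((hpi k).const_mul 2) (integrable_const Z), integral_const_mul]
      simp [mul_comm]
    _ < κ / 2 + κ / 2 := by
      refine add_lt_add_of_le_of_lt ?_ hrv
      calc η * (2 * (∫ y : Body, p k y) + Z + 1) ≤ η * (2 * (P + 1) + Z + 1) := by gcongr
        _ ≤ κ / 2 := by
          rw [hη, div_mul_eq_mul_div, div_le_div_iff₀ hden two_pos]
          nlinarith
    _ = κ := add_halves κ

/-! ### Passage to the limit -/

/-- The properties of the regularized plastic strains `p k` and internal variables `z k` that
determine the limit. -/
structure IsLocalizing (z₀ : Body → ℝ) (p z : ℕ → ℝ → L2) : Prop where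
  mono : ∀ k a b, 0 ≤ a → a ≤ b → p k a ≤ p k b
  nonneg : ∀ k t, 0 ≤ t → 0 ≤ p k t
  stress_nonneg : ∀ k t, 0 ≤ t → 0 ≤ stress (p k) t
  tendsto_stress : ∀ t ≥ 0, Tendsto (fun k => stress (p k) t) atTop (𝓝 (min t 1))
  eq_add : ∀ᶠ k in atTop, ∀ t ≥ 0, ∀ᵐ y : Body, z k t y = z₀ y + p k t y
  concentrate : ∀ r > 0, ∀ᶠ k in atTop, ∀ t ≥ 0, ∀ᵐ y : Body, r ≤ |(y : ℝ)| → p k t y = 0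

theorem isLocalizing_of_isReducedFlow {V : ℝ → ℝ} {M : ℝ} (hV : IsSoftening V M) {z₀ : Body → ℝ}
    (hz₀ : Continuous z₀) (hz₀_origin : z₀ origin = 1)
    (hz₀_ne : ∀ y, y ≠ origin → z₀ y < 1 ∧ 0 ≤ z₀ y) {ε : ℕ → ℝ} (hε : ∀ k, 0 < ε k)
    (hε0 : Tendsto ε atTop (𝓝 0)) {p z p' z' : ℕ → ℝ → L2}
    (h : ∀ k, IsReducedFlow V z₀ (ε k) (p k) (z k) (p' k) (z' k)) : IsLocalizing z₀ p z := by
  have key : ∀ r > 0, ∀ᶠ k in atTop, ∀ t ≥ 0,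
      (min t 1 ≤ stress (p k) t ∧ stress (p k) t ≤ min t 1 + r) ∧
      (∀ᵐ y : Body, z k t y = z₀ y + p k t y) ∧
      (∀ᵐ y : Body, r ≤ |(y : ℝ)| → p k t y = 0) := by
    intro r hr
    obtain ⟨ε₀, hε₀, H⟩ := exists_localization hV hz₀ hz₀_origin hz₀_ne hr
    filter_upwards [hε0.eventually (gt_mem_nhds hε₀)] with k hk
    exact H _ (hε k) hk _ _ _ _ (h k)
  refine ⟨fun k a b ha hab => (h k).p_mono hV (hε k) ha hab,
    fun k t ht => (h k).p_nonneg hV (hε k) ht,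
    fun k t ht => (h k).stress_nonneg hV (hε k) ht, fun t ht => ?_,
    (key 1 one_pos).mono fun k hk t ht => (hk t ht).2.1,
    fun r hr => (key r hr).mono fun k hk t ht => (hk t ht).2.2⟩
  rw [Metric.tendsto_nhds]
  intro r hr
  filter_upwards [key (r / 2) (half_pos hr)] with k hk
  obtain ⟨⟨h1, h2⟩, -⟩ := hk t ht
  rw [Real.dist_eq, abs_lt]
  constructor <;> linarith

/-- The limiting displacement. -/
noncomputable def displacement (t : ℝ) (y : Body) : ℝ :=
  min t 1 * (y : ℝ) + max (t - 1) 0 / 2 * (if 0 < (y : ℝ) then 1 else -1)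

theorem displacement_eq (t : ℝ) (y : Body) : displacement t y =
    if t ≤ 1 then t * (y : ℝ)
    else if 0 < (y : ℝ) then (y : ℝ) + (t - 1) / 2 else (y : ℝ) - (t - 1) / 2 := by
  rw [displacement]
  rcases le_or_gt t 1 with h | h
  · rw [if_pos h, min_eq_left h, max_eq_right (by linarith)]
    ring
  · rw [if_neg h.not_ge, min_eq_right h.le, max_eq_left (by linarith)]
    split_ifs <;> ring

theorem sub_min_one (t : ℝ) : t - min t 1 = max (t - 1) 0 := by
  rcases le_total t 1 with h | h
  · rw [min_eq_left h, max_eq_right (by linarith), sub_self]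
  · rw [min_eq_right h, max_eq_left (by linarith)]

theorem volume_real_Iic (y : Body) : (volume : Measure Body).real (Iic y) = y + 1 / 2 := by
  have h := setIntegral_Iic_body (fun _ => 1) y
  simp only [integral_const, intervalIntegral.integral_const, measureReal_restrict_apply_univ,
    smul_eq_mul, mul_one] at h
  rw [h]
  ring

theorem volume_real_Ioi (y : Body) : (volume : Measure Body).real (Ioi y) = 1 / 2 - y := by
  have h := probReal_compl_eq_one_sub (μ := (volume : Measure Body)) (measurableSet_Iic (a := y))
  rw [compl_Iic, volume_real_Iic] at h
  rw [h]
  ring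

namespace IsLocalizing

variable {z₀ : Body → ℝ} {p z : ℕ → ℝ → L2}

/-- The plastic strains have total mass `t - s(t)`. -/
theorem tendsto_mass (h : IsLocalizing z₀ p z) {t : ℝ} (ht : 0 ≤ t) :
    Tendsto (fun k => ∫ y : Body, p k t y) atTop (𝓝 (max (t - 1) 0)) := by
  rw [← sub_min_one]
  refine ((tendsto_const_nhds (x := t)).sub (h.tendsto_stress t ht)).congr fun k => ?_
  rw [stress]
  ring

theorem ae_nonneg (h : IsLocalizing z₀ p z) (k : ℕ) {t : ℝ} (ht : 0 ≤ t) :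
    ∀ᵐ y : Body, 0 ≤ p k t y := by
  have := h.nonneg k t ht
  rwa [← Lp.coeFn_nonneg] at this

theorem tendsto_delta (h : IsLocalizing z₀ p z) (hz₀ : Continuous z₀) {t : ℝ} (ht : 0 ≤ t)
    (f : CHom 1) :
    Tendsto (fun k => delta (fun _ : Fin 1 => ofDensity (p k t)) (fun _ => ofDensity (z k t)) f)
      atTop (𝓝 ((∫ y : Body, f.1 (y, (fun _ => (0, z₀ y), 1))) +
        max (t - 1) 0 * f.1 (origin, (fun _ => (1, 1), 0)))) := by
  refine (tendsto_integral_concentrating f hz₀ (p := fun k => p k t) (fun k => integrable_L2 _)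
    (Eventually.of_forall fun k => h.ae_nonneg k ht)
    (fun r hr => (h.concentrate r hr).mono fun k hk => hk t ht) (h.tendsto_mass ht)).congr' ?_
  filter_upwards [h.eq_add] with k hk
  rw [delta_ofDensity f (a := fun _ => p k t) (b := fun _ => z k t)
    (fun _ => integrable_L2 _) (fun _ => integrable_L2 _)]
  refine integral_congr_ae ?_
  filter_upwards [hk t ht] with y hy
  rw [hy]

/-- The increments of the dissipation are linear on the cone of the monotone increments
`(p, z) = (a, a)`. -/
theorem tendsto_delta_support (h : IsLocalizing z₀ p z) {n : ℕ} {t : Fin (n + 1) → ℝ}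
    (ht : StrictMono t) (ht0 : ∀ i, 0 ≤ t i) (i : Fin n) {f : CHom (n + 1)}
    (hf : ∀ (y : Body) (ξ : Fin (n + 1) → ℝ × ℝ) (η : ℝ),
      f.1 (y, (ξ, η)) = supportFunction diamond (ξ i.succ - ξ i.castSucc)) :
    Tendsto (fun k => delta (fun i => ofDensity (p k (t i))) (fun i => ofDensity (z k (t i))) f)
      atTop (𝓝 (2 * (max (t i.succ - 1) 0 - max (t i.castSucc - 1) 0))) := by
  refine (((h.tendsto_mass (ht0 i.succ)).sub (h.tendsto_mass (ht0 i.castSucc))).const_mul 2).congr'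
    ?_
  filter_upwards [h.eq_add] with k hk
  rw [delta_ofDensity f (a := fun i => p k (t i)) (b := fun i => z k (t i))
    (fun _ => integrable_L2 _) (fun _ => integrable_L2 _),
    ← integral_sub (integrable_L2 _) (integrable_L2 _), ← integral_const_mul]
  refine integral_congr_ae ?_
  have hm := h.mono k (t i.castSucc) (t i.succ) (ht0 _) (ht Fin.castSucc_lt_succ).le
  rw [← Lp.coeFn_le] at hm
  filter_upwards [hk _ (ht0 i.succ), hk _ (ht0 i.castSucc), hm] with y h1 h2 h3
  rw [hf, supportFunction_diamond]
  simp only [Prod.fst_sub, Prod.snd_sub, h1, h2, add_sub_add_left_eq_sub, max_self]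
  rw [abs_of_nonneg (sub_nonneg.2 h3)]

/-- Convergence of the displacements, tested with a bounded measurable function. -/
theorem tendsto_displacement (h : IsLocalizing z₀ p z) {u : ℕ → ℝ → H1Fun} {t : ℝ} (ht : 0 ≤ t)
    (hu : ∀ k, ∀ᵐ y : Body, (u k t).val y = -(t / 2) + primitive (u k t).grad y)
    (hg : ∀ k, ∀ᵐ y : Body, (u k t).grad y = stress (p k) t + p k t y)
    {g : Body → ℝ} (hgm : Measurable g) {C : ℝ} (hgC : ∀ y, |g y| ≤ C) :
    Tendsto (fun k => ∫ y : Body, (u k t).val y * g y) atTop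
      (𝓝 (∫ y : Body, displacement t y * g y)) := by
  have hgi : ∀ k, Integrable (u k t).grad := fun k => integrable_L2 _
  have hC0 : 0 ≤ C := (abs_nonneg _).trans (hgC origin)
  have htot : ∀ k, ∫ y : Body, (u k t).grad y = t := by
    intro k
    rw [integral_congr_ae (hg k), integral_add (integrable_const _) (integrable_L2 _), stress]
    simp
  have hnn : ∀ k, ∀ᵐ y : Body, 0 ≤ (u k t).grad y := by
    intro k
    filter_upwards [hg k, h.ae_nonneg k ht] with y h1 h2
    rw [h1]
    exact add_nonneg (h.stress_nonneg k t ht) h2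
  have hbd : ∀ k y, |primitive (u k t).grad y| ≤ t := by
    intro k y
    have h0 : 0 ≤ primitive (u k t).grad y :=
      setIntegral_nonneg_of_ae_restrict (ae_restrict_of_ae (hnn k))
    rw [abs_of_nonneg h0]
    exact (setIntegral_le_integral (hgi k) (hnn k)).trans (htot k).le
  have hcongr : ∀ k, ∫ y : Body, (u k t).val y * g y =
      ∫ y : Body, (-(t / 2) + primitive (u k t).grad y) * g y := fun k => by
    refine integral_congr_ae ?_
    filter_upwards [hu k] with y hy
    rw [hy]
  simp only [hcongr]
  refine tendsto_integral_of_dominated_convergence (fun _ => (t / 2 + t) * C) ?_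
    (integrable_const _) ?_ ?_
  · intro k
    exact ((continuous_const.add (continuous_primitive (hgi k))).measurable.mul
      hgm).aestronglyMeasurable
  · intro k
    refine Eventually.of_forall fun y => ?_
    rw [norm_mul]
    refine mul_le_mul ?_ (hgC y) (abs_nonneg _) (by positivity)
    refine (norm_add_le _ _).trans (add_le_add ?_ (hbd k y))
    rw [norm_neg, Real.norm_of_nonneg (by positivity)]
  · filter_upwards [ae_ne_origin] with y hy
    refine Tendsto.mul_const _ ?_
    have hy0 : (y : ℝ) ≠ 0 := fun h0 => hy (Subtype.ext h0)
    have hconc := h.concentrate |(y : ℝ)| (abs_pos.2 hy0)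
    have hmass : ∀ s : Set Body, MeasurableSet s → (∀ x ∈ s, |(y : ℝ)| ≤ |(x : ℝ)|) →
        ∀ᶠ k in atTop, ∫ x in s, (u k t).grad x = volume.real s * stress (p k) t := by
      intro s hs hsy
      filter_upwards [hconc] with k hk
      rw [← smul_eq_mul, ← setIntegral_const]
      refine setIntegral_congr_ae hs ?_
      filter_upwards [hk t ht, hg k] with x h1 h2 hx
      rw [h2, h1 (hsy x hx), add_zero]
    have hst := h.tendsto_stress t ht
    have hmm := sub_min_one t
    -- The displacement at `y` is obtained by integrating the gradient from the nearer end point, so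
    -- that the origin is not crossed.
    rcases lt_or_gt_of_ne hy0 with hneg | hpos
    · have h1 := hmass (Iic y) measurableSet_Iic fun x hx => by
        have hx : (x : ℝ) ≤ y := hx
        rw [abs_of_neg hneg, abs_of_neg (hx.trans_lt hneg)]
        linarith
      have h2 := (hst.const_mul ((y : ℝ) + 1 / 2)).const_add (-(t / 2))
      have h3 : -(t / 2) + ((y : ℝ) + 1 / 2) * min t 1 = displacement t y := by
        rw [displacement, if_neg (not_lt.2 hneg.le), ← hmm]
        ring
      rw [h3] at h2
      refine h2.congr' ?_
      filter_upwards [h1] with k hk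
      rw [primitive, hk, volume_real_Iic]
    · have h1 := hmass (Ioi y) measurableSet_Ioi fun x hx => by
        have hx : (y : ℝ) < x := hx
        rw [abs_of_pos hpos, abs_of_pos (hpos.trans hx)]
        linarith
      have h2 := ((hst.const_mul (1 / 2 - (y : ℝ))).const_sub t).const_add (-(t / 2))
      have h3 : -(t / 2) + (t - (1 / 2 - (y : ℝ)) * min t 1) = displacement t y := by
        rw [displacement, if_pos hpos, ← hmm]
        ring
      rw [h3] at h2
      refine h2.congr' ?_
      filter_upwards [h1] with k hk
      have h4 := integral_add_compl (measurableSet_Iic (a := y)) (hgi k)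
      rw [compl_Iic, hk, htot k, volume_real_Ioi] at h4
      rw [primitive]
      linarith

end IsLocalizing

/-! ### Approximation of times from the left -/

section Times

variable {Θ : Set ℝ}

theorem exists_seq_tendsto_left (h0 : 0 ∈ Θ) (hΘ : volume (Ici (0 : ℝ) \ Θ) = 0) {t : ℝ}
    (ht : 0 ≤ t) : ∃ a : ℕ → ℝ, (∀ n, a n ∈ Θ) ∧ Tendsto a atTop (𝓝[Icc 0 t] t) := by
  suffices hcl : t ∈ closure (Θ ∩ Icc 0 t) by
    obtain ⟨a, ha, hlim⟩ := mem_closure_iff_seq_limit.1 hcl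
    exact ⟨a, fun n => (ha n).1,
      tendsto_nhdsWithin_iff.2 ⟨hlim, Eventually.of_forall fun n => (ha n).2⟩⟩
  rcases ht.eq_or_lt with rfl | htpos
  · exact subset_closure ⟨h0, le_rfl, le_rfl⟩
  rw [Metric.mem_closure_iff]
  intro δ hδ
  by_contra! hcon
  have hlt : max 0 (t - δ) < t := max_lt htpos (by linarith)
  have hsub : Ioo (max 0 (t - δ)) t ⊆ Ici 0 \ Θ := by
    intro x hx
    have hx0 := (le_max_left 0 (t - δ)).trans hx.1.le
    refine ⟨hx0, fun hxΘ => ?_⟩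
    have h1 := hcon x ⟨hxΘ, hx0, hx.2.le⟩
    have h2 := (le_max_right 0 (t - δ)).trans_lt hx.1
    rw [Real.dist_eq, abs_of_pos (by linarith [hx.2])] at h1
    linarith
  have h1 := measure_mono_null hsub hΘ
  rw [Real.volume_Ioo, ENNReal.ofReal_eq_zero] at h1
  linarith

theorem exists_seq_tendsto_left_pi (h0 : 0 ∈ Θ) (hΘ : volume (Ici (0 : ℝ) \ Θ) = 0) {m : ℕ}
    {t : Fin m → ℝ} (ht : StrictMono t) (ht0 : ∀ i, 0 ≤ t i) :
    ∃ a : ℕ → Fin m → ℝ, (∀ n, StrictMono (a n)) ∧ (∀ n i, a n i ∈ Θ) ∧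
      Tendsto a atTop (𝓝[{s | StrictMono s ∧ ∀ i, 0 ≤ s i ∧ s i ≤ t i}] t) := by
  choose a haΘ ha using fun i => exists_seq_tendsto_left h0 hΘ (ht0 i)
  have hlim : ∀ i, Tendsto (a i) atTop (𝓝 (t i)) := fun i => (tendsto_nhdsWithin_iff.1 (ha i)).1
  have hmem : ∀ᶠ n in atTop, ∀ i, a i n ∈ Icc 0 (t i) :=
    eventually_all.2 fun i => (tendsto_nhdsWithin_iff.1 (ha i)).2
  have hmono : ∀ᶠ n in atTop, StrictMono fun i => a i n := by
    have : ∀ᶠ n in atTop, ∀ i j, i < j → a i n < a j n := by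
      refine eventually_all.2 fun i => eventually_all.2 fun j => ?_
      by_cases hij : i < j
      · exact ((hlim i).eventually_lt (hlim j) (ht hij)).mono fun n hn _ => hn
      · exact Eventually.of_forall fun n h => absurd h hij
    exact this.mono fun n hn i j hij => hn i j hij
  obtain ⟨N, hN⟩ := eventually_atTop.1 (hmem.and hmono)
  refine ⟨fun n i => a i (n + N), fun n => (hN _ (Nat.le_add_left N n)).2,
    fun n i => haΘ i _, tendsto_nhdsWithin_iff.2 ⟨?_, Eventually.of_forall fun n =>
      ⟨(hN _ (Nat.le_add_left N n)).2, (hN _ (Nat.le_add_left N n)).1⟩⟩⟩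
  exact tendsto_pi_nhds.2 fun i => (hlim i).comp (tendsto_add_atTop_nat N)

end Times

/-! ### The limit evolution -/

theorem ae_eq_of_forall_integral_mul {v v' : Body → ℝ} (hv : Integrable v) (hv' : Integrable v')
    (h : ∀ s : Set Body, MeasurableSet s → ∫ y : Body, v y * s.indicator (fun _ => 1) y =
      ∫ y : Body, v' y * s.indicator (fun _ => 1) y) : ∀ᵐ y : Body, v y = v' y := by
  refine hv.ae_eq_of_forall_setIntegral_eq v v' hv' fun s hs _ => ?_
  have h1 := h s hs
  have h2 : ∀ f : Body → ℝ, (fun y => f y * s.indicator (fun _ => (1 : ℝ)) y) = s.indicator f := by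
    intro f
    ext y
    by_cases hy : y ∈ s <;> simp [hy]
  rwa [h2, h2, integral_indicator hs, integral_indicator hs] at h1

theorem integrable_displacement_part (g : Body → ℝ) (hg : Integrable g) :
    Integrable (fun y : Body => (y : ℝ) * g y) ∧
      Integrable (fun y : Body => (if 0 < (y : ℝ) then (1 : ℝ) else -1) * g y) := by
  have hm : Measurable fun y : Body => (if 0 < (y : ℝ) then (1 : ℝ) else -1) :=
    Measurable.ite (measurableSet_lt measurable_const measurable_subtype_coe) measurable_const
      measurable_const
  refine ⟨hg.bdd_mul (c := 1) (by fun_prop) (Eventually.of_forall fun y => ?_),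
    hg.bdd_mul (c := 1) hm.aestronglyMeasurable (Eventually.of_forall fun y => ?_)⟩
  · rw [Real.norm_eq_abs, abs_le]
    constructor <;> linarith [y.2.1, y.2.2]
  · split_ifs <;> simp

theorem integral_displacement_mul (t : ℝ) {g : Body → ℝ} (hg : Integrable g) :
    Integrable (fun y : Body => displacement t y * g y) ∧
    ∫ y : Body, displacement t y * g y = min t 1 * (∫ y : Body, (y : ℝ) * g y) +
      max (t - 1) 0 / 2 * ∫ y : Body, (if 0 < (y : ℝ) then (1 : ℝ) else -1) * g y := by
  obtain ⟨h1, h2⟩ := integrable_displacement_part g hg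
  have h3 : (fun y : Body => displacement t y * g y) = fun y : Body => min t 1 * ((y : ℝ) * g y) +
      max (t - 1) 0 / 2 * ((if 0 < (y : ℝ) then (1 : ℝ) else -1) * g y) := by
    ext y
    rw [displacement]
    ring
  rw [h3]
  refine ⟨(h1.const_mul _).add (h2.const_mul _), ?_⟩
  rw [integral_add (h1.const_mul _) (h2.const_mul _), integral_const_mul, integral_const_mul]

section Limit

variable {V : ℝ → ℝ} {M : ℝ} {z₀ : Body → ℝ} {u : ℝ → BVFun} {e : ℝ → L2} {μ : YoungFamily}

/-- The limit of the regularized evolutions, at all times. -/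
theorem IsApproximableEvolution.limit (hV : IsSoftening V M)
    (hz₀ : Continuous z₀) (hz₀_origin : z₀ origin = 1)
    (hz₀_ne : ∀ y, y ≠ origin → z₀ y < 1 ∧ 0 ≤ z₀ y)
    (h : IsApproximableEvolution (1 / 2) diamond V (fun t y => t * y) (fun _ => 0) (fun _ => 0)
      (fun _ => 0) z₀ u e μ) :
    (∀ t ≥ 0, ∀ᵐ y : Body, (u t).val y = displacement t y) ∧
    (∀ t ≥ 0, ∀ᵐ y : Body, e t y = min t 1) ∧
    (∀ t ≥ 0, ∀ f : CHom 1, μ 1 (fun _ => t) f =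
      (∫ y : Body, f.1 (y, (fun _ => (0, z₀ y), 1))) +
        max (t - 1) 0 * f.1 (origin, (fun _ => (1, 1), 0))) ∧
    (∀ (n : ℕ) (t : Fin (n + 1) → ℝ), StrictMono t → (∀ i, 0 ≤ t i) → ∀ (i : Fin n)
      (f : CHom (n + 1)), (∀ (y : Body) (ξ : Fin (n + 1) → ℝ × ℝ) (η : ℝ),
        f.1 (y, (ξ, η)) = supportFunction diamond (ξ i.succ - ξ i.castSucc)) →
      μ (n + 1) t f = 2 * (max (t i.succ - 1) 0 - max (t i.castSucc - 1) 0)) := by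
  obtain ⟨ε, Θ, uε, eε, pε, zε, hε, hε0, hΘ0, h0Θ, hΘ, hreg, hu, he, hμ⟩ := h.approximable
  choose p' z' hflow using fun k => (hreg k).exists_isReducedFlow
  have hloc := isLocalizing_of_isReducedFlow hV hz₀ hz₀_origin hz₀_ne hε hε0 hflow
  have hcmin : Continuous fun t : ℝ => min t 1 := by fun_prop
  have hcmax : Continuous fun t : ℝ => max (t - 1) 0 := by fun_prop
  refine ⟨fun t ht => ?_, fun t ht => ?_, fun t ht f => ?_, fun n t ht ht0 i f hf => ?_⟩
  · have hdi : Integrable (displacement t) := by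
      simpa using (integral_displacement_mul t (integrable_const (1 : ℝ))).1
    refine ae_eq_of_forall_integral_mul (L1.integrable_coeFn _) hdi fun s hs => ?_
    set g : Body → ℝ := s.indicator fun _ => 1 with hg
    have hgm : Measurable g := measurable_const.indicator hs
    have hgC : ∀ y, |g y| ≤ 1 := by
      intro y
      by_cases hy : y ∈ s <;> simp [hg, hy]
    have hgi : Integrable g := (integrable_const _).indicator hs
    have hT : ∀ r ∈ Θ, ∫ y : Body, (u r).val y * g y = ∫ y : Body, displacement r y * g y := by
      intro r hr
      exact tendsto_nhds_unique ((hu r hr).1 g hgm ⟨1, hgC⟩)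
        (hloc.tendsto_displacement (hΘ0 hr) (fun k => ((hreg k).strain (hΘ0 hr)).2.2)
          (fun k => ((hreg k).strain (hΘ0 hr)).2.1) hgm hgC)
    obtain ⟨a, haΘ, ha⟩ := exists_seq_tendsto_left h0Θ hΘ ht
    have h1 := ((h.left_continuous_u t ht).1 g hgm ⟨1, hgC⟩).comp ha
    have hc : Continuous fun r => ∫ y : Body, displacement r y * g y := by
      simp only [fun r => (integral_displacement_mul r hgi).2]
      fun_prop
    have h2 := (hc.tendsto t).comp (ha.mono_right nhdsWithin_le_nhds)
    refine tendsto_nhds_unique h1 (h2.congr fun n => ?_)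
    exact (hT _ (haΘ n)).symm
  · refine ae_eq_of_forall_integral_mul (integrable_L2 _) (integrable_const _) fun s hs => ?_
    set g : L2 := indicatorConstLp 2 hs (measure_ne_top volume s) (1 : ℝ) with hg
    have hgs : ∀ v : Body → ℝ, ∫ y : Body, v y * g y =
        ∫ y : Body, v y * s.indicator (fun _ => 1) y := by
      intro v
      refine integral_congr_ae ?_
      filter_upwards [indicatorConstLp_coeFn (p := 2) (hs := hs)
        (hμs := measure_ne_top volume s) (c := (1 : ℝ))] with y hy
      rw [hy]
    rw [← hgs, ← hgs]
    have hT : ∀ r ∈ Θ, ∫ y : Body, e r y * g y = min r 1 * ∫ y : Body, g y := by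
      intro r hr
      refine tendsto_nhds_unique (he r hr g)
        (((hloc.tendsto_stress r (hΘ0 hr)).mul_const _).congr fun k => ?_)
      rw [← integral_const_mul]
      refine integral_congr_ae ?_
      filter_upwards [((hreg k).strain (hΘ0 hr)).1] with y hy
      rw [hy]
    obtain ⟨a, haΘ, ha⟩ := exists_seq_tendsto_left h0Θ hΘ ht
    have h1 := (h.left_continuous_e t ht g).comp ha
    have h2 := ((hcmin.mul_const (∫ y : Body, g y)).tendsto t).comp
      (ha.mono_right nhdsWithin_le_nhds)
    rw [integral_const_mul]
    refine tendsto_nhds_unique h1 (h2.congr fun n => ?_)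
    exact (hT _ (haΘ n)).symm
  · have hsm : ∀ r : ℝ, StrictMono fun _ : Fin 1 => r := fun r => Subsingleton.strictMono _
    obtain ⟨a, -, haΘ, ha⟩ := exists_seq_tendsto_left_pi h0Θ hΘ (hsm t) (fun _ => ht)
    have hT : ∀ r : Fin 1 → ℝ, (∀ i, r i ∈ Θ) → μ 1 r f =
        (∫ y : Body, f.1 (y, (fun _ => (0, z₀ y), 1))) +
          max (r 0 - 1) 0 * f.1 (origin, (fun _ => (1, 1), 0)) := by
      intro r hr
      have hr0 : r = fun _ => r 0 := funext fun i => by rw [Subsingleton.elim i 0]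
      refine tendsto_nhds_unique (hμ 1 r (Subsingleton.strictMono _) hr f) ?_
      rw [hr0]
      exact hloc.tendsto_delta hz₀ (hΘ0 (hr 0)) f
    have h1 := (h.left_continuous_system 1 _ (hsm t) (fun _ => ht) f).comp ha
    have hc : Continuous fun r : Fin 1 → ℝ => (∫ y : Body, f.1 (y, (fun _ => (0, z₀ y), 1))) +
        max (r 0 - 1) 0 * f.1 (origin, (fun _ => (1, 1), 0)) := by fun_prop
    have h2 := (hc.tendsto fun _ => t).comp (ha.mono_right nhdsWithin_le_nhds)
    refine tendsto_nhds_unique h1 (h2.congr fun n => ?_)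
    exact (hT _ (haΘ n)).symm
  · obtain ⟨a, ham, haΘ, ha⟩ := exists_seq_tendsto_left_pi h0Θ hΘ ht ht0
    have hT : ∀ r : Fin (n + 1) → ℝ, StrictMono r → (∀ i, r i ∈ Θ) → μ (n + 1) r f =
        2 * (max (r i.succ - 1) 0 - max (r i.castSucc - 1) 0) := by
      intro r hrm hr
      exact tendsto_nhds_unique (hμ _ r hrm hr f)
        (hloc.tendsto_delta_support hrm (fun i => hΘ0 (hr i)) i hf)
    have h1 := (h.left_continuous_system _ _ ht ht0 f).comp ha
    have hc : Continuous fun r : Fin (n + 1) → ℝ =>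
        2 * (max (r i.succ - 1) 0 - max (r i.castSucc - 1) 0) := by fun_prop
    have h2 := (hc.tendsto t).comp (ha.mono_right nhdsWithin_le_nhds)
    refine tendsto_nhds_unique h1 (h2.congr fun n => ?_)
    exact (hT _ (ham n) (haΘ n)).symm

end Limit

/-! ### Dissipation -/

/-- The function `H(ξ_{i+1} - ξ_i, θ_{i+1} - θ_i)`. -/
noncomputable def supportIncrement {n : ℕ} (i : Fin n) : CHom (n + 1) :=
  ⟨⟨fun x => 2 * max |(x.2.1 i.succ).1 - (x.2.1 i.castSucc).1|
      |(x.2.1 i.succ).2 - (x.2.1 i.castSucc).2|, by fun_prop⟩, by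
    intro y c hc v
    simp only [ContinuousMap.coe_mk, Prod.smul_fst, Pi.smul_apply, Prod.smul_snd, smul_eq_mul,
      ← mul_sub, abs_mul, abs_of_nonneg hc]
    rw [← mul_max_of_nonneg _ _ hc]
    ring⟩

theorem supportIncrement_apply {n : ℕ} (i : Fin n) (y : Body) (ξ : Fin (n + 1) → ℝ × ℝ) (η : ℝ) :
    (supportIncrement i).1 (y, (ξ, η)) =
      supportFunction diamond (ξ i.succ - ξ i.castSucc) := by
  rw [supportFunction_diamond]
  rfl

theorem sum_succ_sub_castSucc (φ : ℝ → ℝ) : ∀ {n : ℕ} (t : Fin (n + 1) → ℝ),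
    ∑ i : Fin n, (φ (t i.succ) - φ (t i.castSucc)) = φ (t (Fin.last n)) - φ (t 0)
  | 0, t => by simp
  | n + 1, t => by
    rw [Fin.sum_univ_castSucc]
    have := sum_succ_sub_castSucc φ (fun i : Fin (n + 1) => t i.castSucc)
    simp only [Fin.succ_castSucc, Fin.castSucc_zero] at this ⊢
    rw [this]
    simp

theorem dissipationSums_eq_singleton {μ : YoungFamily}
    (h : ∀ (n : ℕ) (t : Fin (n + 1) → ℝ), StrictMono t → (∀ i, 0 ≤ t i) → ∀ (i : Fin n)
      (f : CHom (n + 1)), (∀ (y : Body) (ξ : Fin (n + 1) → ℝ × ℝ) (η : ℝ),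
        f.1 (y, (ξ, η)) = supportFunction diamond (ξ i.succ - ξ i.castSucc)) →
      μ (n + 1) t f = 2 * (max (t i.succ - 1) 0 - max (t i.castSucc - 1) 0))
    {T : ℝ} (hT : 0 < T) : dissipationSums diamond μ 0 T = {2 * max (T - 1) 0} := by
  have key : ∀ (n : ℕ) (t : Fin (n + 1) → ℝ) (f : Fin n → CHom (n + 1)), StrictMono t → t 0 = 0 →
      t (Fin.last n) = T → (∀ (i : Fin n) (y : Body) (ξ : Fin (n + 1) → ℝ × ℝ) (η : ℝ),
        (f i).1 (y, (ξ, η)) = supportFunction diamond (ξ i.succ - ξ i.castSucc)) →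
      ∑ i, μ (n + 1) t (f i) = 2 * max (T - 1) 0 := by
    intro n t f ht h0 h1 hf
    have hnn : ∀ i, 0 ≤ t i := fun i => h0 ▸ ht.monotone (Fin.zero_le i)
    simp only [fun i => h n t ht hnn i (f i) (hf i)]
    rw [← Finset.mul_sum, sum_succ_sub_castSucc (fun s => max (s - 1) 0) t, h0, h1]
    norm_num
  ext S
  rw [mem_singleton_iff]
  constructor
  · rintro ⟨n, t, f, ht, h0, h1, hf, rfl⟩
    exact key n t f ht h0 h1 hf
  · rintro rfl
    have ht : StrictMono (![0, T] : Fin 2 → ℝ) := by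
      rw [Fin.strictMono_iff_lt_succ]
      intro i
      fin_cases i
      simpa using hT
    exact ⟨1, ![0, T], supportIncrement, ht, rfl, rfl, supportIncrement_apply,
      (key 1 ![0, T] supportIncrement ht rfl rfl supportIncrement_apply).symm⟩

/-! ### The homogenized potential -/

namespace IsSoftening

variable {V : ℝ → ℝ} {M : ℝ} (h : IsSoftening V M)
include h

/-- Outside `(-1, 1)` the potential is affine with slope `-1` in `|θ|`. -/
theorem add_abs_eq {θ : ℝ} (hθ : 1 ≤ |θ|) : V θ + |θ| = V 1 + 1 := by
  have key : ∀ θ, 1 ≤ θ → V θ + θ = V 1 + 1 := by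
    intro θ hθ
    have hd : ∀ x, HasDerivAt V (deriv V x) x := fun x => (h.differentiable x).hasDerivAt
    refine constant_of_has_deriv_right_zero (f := fun x => V x + x) (a := 1) (b := θ)
      (h.differentiable.continuous.add continuous_id).continuousOn (fun x hx => ?_) θ ⟨hθ, le_rfl⟩
    have h1 := (hd x).add (hasDerivAt_id x)
    rw [(h.deriv_eq_iff x).2 hx.1, neg_add_cancel] at h1
    exact h1.hasDerivWithinAt
  rcases abs_cases θ with ⟨h1, h2⟩ | ⟨h1, h2⟩
  · rw [h1] at hθ ⊢
    exact key θ hθ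
  · rw [h1] at hθ ⊢
    rw [h.even]
    exact key _ hθ

theorem exists_abs_add_abs_le : ∃ B ≥ 0, ∀ θ, |V θ + abs θ| ≤ B := by
  obtain ⟨B, hB⟩ := (isCompact_Icc (a := (-1 : ℝ)) (b := 1)).exists_bound_of_continuousOn
    (f := fun θ => V θ + |θ|) (h.differentiable.continuous.add continuous_abs).continuousOn
  have h1 := hB 1 (by norm_num)
  refine ⟨B, (norm_nonneg _).trans h1, fun θ => ?_⟩
  rcases le_total |θ| 1 with hθ | hθ
  · exact hB θ (abs_le.1 hθ)
  · rw [h.add_abs_eq hθ]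
    simpa using h1

theorem recession_eq (θ : ℝ) : recession V θ = -|θ| := by
  obtain ⟨B, -, hB⟩ := h.exists_abs_add_abs_le
  refine Tendsto.limUnder_eq ?_
  have h1 : Tendsto (fun s : ℝ => (V (s * θ) + |s * θ|) / s) atTop (𝓝 0) := by
    refine squeeze_zero_norm' (a := fun s => B / s) ?_ (tendsto_const_nhds.div_atTop tendsto_id)
    filter_upwards [eventually_gt_atTop 0] with s hs
    rw [norm_div, Real.norm_of_nonneg hs.le]
    exact div_le_div_of_nonneg_right (hB _) hs.le
  have h2 := h1.sub_const |θ|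
  rw [zero_sub] at h2
  refine h2.congr' ?_
  filter_upwards [eventually_gt_atTop 0] with s hs
  rw [abs_mul, abs_of_pos hs]
  field_simp
  ring

/-- The homogenized potential is `-|θ|` up to the perspective of the bounded function `V + |·|`. -/
theorem homogenized_eq (θ η : ℝ) : homogenized V θ η =
    (if 0 < η then η * (V (θ / η) + |θ / η|) else 0) - |θ| := by
  rw [homogenized]
  split_ifs with hη
  · rw [abs_div, abs_of_pos hη]
    field_simp
    ring
  · rw [h.recession_eq, zero_sub]

theorem continuous_homogenized : Continuous fun q : ℝ × ℝ => homogenized V q.1 q.2 := by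
  simp only [h.homogenized_eq]
  refine Continuous.sub ?_ (by fun_prop)
  rw [continuous_iff_continuousAt]
  rintro ⟨θ, η⟩
  obtain ⟨B, hB0, hB⟩ := h.exists_abs_add_abs_le
  rcases lt_or_ge 0 η with hη | hη
  · have hc : ContinuousAt (fun q : ℝ × ℝ => q.2 * (V (q.1 / q.2) + |q.1 / q.2|)) (θ, η) := by
      have h1 : ContinuousAt (fun q : ℝ × ℝ => q.1 / q.2) (θ, η) :=
        continuousAt_fst.div continuousAt_snd hη.ne'
      have h2 : ContinuousAt (fun q : ℝ × ℝ => V (q.1 / q.2)) (θ, η) :=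
        h.differentiable.continuous.continuousAt.comp h1
      exact continuousAt_snd.mul (h2.add h1.abs)
    refine hc.congr ?_
    have : ∀ᶠ q : ℝ × ℝ in 𝓝 (θ, η), 0 < q.2 := continuousAt_snd.eventually (lt_mem_nhds hη)
    filter_upwards [this] with q hq
    rw [if_pos hq]
  · rw [ContinuousAt, if_neg (not_lt.2 hη)]
    refine squeeze_zero_norm (a := fun q : ℝ × ℝ => max q.2 0 * B) ?_ ?_
    · intro q
      split_ifs with hq
      · rw [norm_mul, Real.norm_of_nonneg hq.le]
        exact mul_le_mul (le_max_left _ _) (hB _) (norm_nonneg _) (le_max_right _ _)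
      · rw [norm_zero]
        exact mul_nonneg (le_max_right _ _) hB0
    · have hc : Continuous fun q : ℝ × ℝ => max q.2 0 * B := by fun_prop
      have := hc.tendsto (θ, η)
      simpa only [max_eq_right hη, zero_mul] using this

theorem homogenized_mul (θ η : ℝ) {c : ℝ} (hc : 0 ≤ c) :
    homogenized V (c * θ) (c * η) = c * homogenized V θ η := by
  rw [h.homogenized_eq, h.homogenized_eq, abs_mul, abs_of_nonneg hc]
  rcases hc.eq_or_lt with rfl | hc
  · simp
  · rw [mul_div_mul_left _ _ hc.ne']
    by_cases hη : 0 < η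
    · rw [if_pos hη, if_pos (mul_pos hc hη)]
      ring
    · rw [if_neg hη, if_neg (by rwa [mul_pos_iff_of_pos_left hc])]
      ring

theorem exists_homogenized : ∃ f : CHom 1, ∀ (y : Body) (ξ : Fin 1 → ℝ × ℝ) (η : ℝ),
    f.1 (y, (ξ, η)) = homogenized V (ξ 0).2 η := by
  refine ⟨⟨⟨fun x => homogenized V (x.2.1 0).2 x.2.2, ?_⟩, ?_⟩, fun _ _ _ => rfl⟩
  · exact h.continuous_homogenized.comp
      (f := fun x : Body × Fibre 1 => ((x.2.1 0).2, x.2.2)) (by fun_prop)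
  · intro y c hc v
    exact h.homogenized_mul _ _ hc

end IsSoftening

theorem integral_min_one {T : ℝ} (hT : 0 < T) :
    ∫ t in (0 : ℝ)..T, min t 1 = min T 1 ^ 2 / 2 + max (T - 1) 0 := by
  have key : ∀ S : ℝ, 0 ≤ S → S ≤ 1 → ∫ t in (0 : ℝ)..S, min t 1 = S ^ 2 / 2 := by
    intro S h0 h1
    rw [intervalIntegral.integral_congr (g := fun t => t), integral_id]
    · ring
    · intro t ht
      rw [uIcc_of_le h0] at ht
      exact min_eq_left (ht.2.trans h1)
  have hc : Continuous fun t : ℝ => min t 1 := by fun_prop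
  rcases le_total T 1 with h | h
  · rw [key T hT.le h, min_eq_left h, max_eq_right (by linarith), add_zero]
  · rw [← intervalIntegral.integral_add_adjacent_intervals (hc.intervalIntegrable 0 1)
      (hc.intervalIntegrable 1 T), key 1 zero_le_one le_rfl,
      intervalIntegral.integral_congr (a := 1) (g := fun _ => 1), min_eq_right h,
      max_eq_left (by linarith)]
    · simp
    · intro t ht
      rw [uIcc_of_le h] at ht
      exact min_eq_right ht.1

end ShearBand

theorem mainTheorem7 (V : ℝ → ℝ) (hV : ContDiff ℝ 2 V)
    (hV2 : ∃ M : ℝ, ∀ θ, -M ≤ deriv (deriv V) θ ∧ deriv (deriv V) θ ≤ 0)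
    (hVeven : ∀ θ, V θ = V (-θ))
    (hV1 : ∀ θ, deriv V θ = -1 ↔ 1 ≤ θ)
    (K : Set (ℝ × ℝ)) (hK : K = {q | |q.1| + |q.2| ≤ 2})
    (w : ℝ → ℝ → ℝ) (hw : ∀ t y, w t y = t * y)
    (z₀ : ShearBand.Body → ℝ) (hz₀ : Continuous z₀)
    (hz₀_origin : z₀ ShearBand.origin = 1)
    (hz₀_ne : ∀ y, y ≠ ShearBand.origin → z₀ y < 1 ∧ 0 ≤ z₀ y)
    (u : ℝ → ShearBand.BVFun) (e : ℝ → ShearBand.L2) (μ : ShearBand.YoungFamily)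
    (h : ShearBand.IsApproximableEvolution (1 / 2) K V w
      (fun _ => 0) (fun _ => 0) (fun _ => 0) z₀ u e μ) :
    (∀ t : ℝ, 0 ≤ t →
      (∀ᵐ y : ShearBand.Body, (u t).val y =
        if t ≤ 1 then t * (y : ℝ)
        else if 0 < (y : ℝ) then (y : ℝ) + (t - 1) / 2 else (y : ℝ) - (t - 1) / 2) ∧
      (∀ᵐ y : ShearBand.Body, e t y = min t 1) ∧
      (∀ f : ShearBand.CHom 1, μ 1 (fun _ => t) f =
        ShearBand.delta
          (fun _ => max (t - 1) 0 •
            (MeasureTheory.Measure.dirac ShearBand.origin).toSignedMeasure)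
          (fun _ => ShearBand.ofDensity z₀ + max (t - 1) 0 •
            (MeasureTheory.Measure.dirac ShearBand.origin).toSignedMeasure) f)) ∧
    (∀ T : ℝ, 0 < T →
      IsLUB (ShearBand.dissipationSums K μ 0 T) (2 * max (T - 1) 0) ∧
      ∃ f : ShearBand.CHom 1,
        (∀ (y : ShearBand.Body) (ξ : Fin 1 → ℝ × ℝ) (η : ℝ),
          f.1 (y, (ξ, η)) = ShearBand.homogenized V (ξ 0).2 η) ∧
        ShearBand.elasticEnergy (1 / 2) (e T) + ShearBand.dissipation K μ 0 T
            + μ 1 (fun _ => T) f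
          = ShearBand.elasticEnergy (1 / 2) (fun _ => 0)
            + (∫ y : ShearBand.Body, V (z₀ y))
            + ShearBand.externalWork (1 / 2) w e T) := by
  obtain ⟨M, hM⟩ := hV2
  have hS : ShearBand.IsSoftening V M :=
    ⟨hV, fun θ => (hM θ).1, fun θ => (hM θ).2, hVeven, hV1⟩
  obtain rfl : K = ShearBand.diamond := hK
  obtain rfl : w = fun t y => t * y := funext fun t => funext fun y => hw t y
  obtain ⟨hu, he, hμ, hd⟩ := h.limit hS hz₀ hz₀_origin hz₀_ne
  have hz₀i : MeasureTheory.Integrable z₀ := hz₀.integrable_of_hasCompactSupport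
    (HasCompactSupport.of_compactSpace _)
  refine ⟨fun t ht => ⟨?_, he t ht, fun f => ?_⟩, fun T hT => ?_⟩
  · filter_upwards [hu t ht] with y hy
    rw [hy, ShearBand.displacement_eq]
  · rw [hμ t ht f, ShearBand.delta_ofDensity_add_dirac f hz₀i (le_max_right _ _)]
    exact ShearBand.CHom.integrable_comp f (a := fun _ _ => 0) (b := fun _ => z₀)
      (fun _ => MeasureTheory.integrable_const _) (fun _ => hz₀i)
  · have hsums := ShearBand.dissipationSums_eq_singleton hd hT
    refine ⟨by rw [hsums]; exact isLUB_singleton, ?_⟩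
    obtain ⟨f, hf⟩ := hS.exists_homogenized
    refine ⟨f, hf, ?_⟩
    have hQ : ShearBand.elasticEnergy (1 / 2) (e T) = min T 1 ^ 2 / 2 := by
      rw [ShearBand.elasticEnergy, MeasureTheory.integral_congr_ae
        (g := fun _ => min T 1 ^ 2 / 2)]
      · simp
      · filter_upwards [he T hT.le] with y hy
        rw [hy]
        ring
    have hD : ShearBand.dissipation ShearBand.diamond μ 0 T = 2 * max (T - 1) 0 := by
      rw [ShearBand.dissipation, hsums, csSup_singleton]
    have hE : μ 1 (fun _ => T) f = (∫ y : ShearBand.Body, V (z₀ y)) - max (T - 1) 0 := by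
      rw [hμ T hT.le f]
      simp only [hf, hS.homogenized_eq]
      norm_num
      ring
    have hQ0 : ShearBand.elasticEnergy (1 / 2) (fun _ => 0) = 0 := by
      simp [ShearBand.elasticEnergy]
    have hW : ShearBand.externalWork (1 / 2) (fun t y => t * y) e T =
        min T 1 ^ 2 / 2 + max (T - 1) 0 := by
      rw [ShearBand.externalWork, ← ShearBand.integral_min_one hT]
      refine intervalIntegral.integral_congr fun t ht => ?_
      rw [uIcc_of_le hT.le] at ht
      have h1 : ∀ y : ℝ, deriv (fun x => deriv (fun s : ℝ => s * x) t) y = 1 := by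
        intro y
        simp
      simp only [h1]
      rw [MeasureTheory.integral_congr_ae (g := fun _ => min t 1)]
      · simp
      · filter_upwards [he t ht.1] with y hy
        rw [hy]
        ring
    rw [hQ, hD, hE, hQ0, hW]
    ring
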